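/- **Theorem 3.1.** Let $n\ge 1$ be an integer, let $p,q>1$ be real, let $K\subset\mathbb{R}^n$ be a convex body (a compact convex set) containing the origin in its interior, with support function $h_K(v)=\max\{\langle v,y\rangle: y\in K\}$, and let $f:\mathbb{S}^{n-1}\to\mathbb{R}$ be continuous. Here $s^p$ is the usual power for $s\ge 0$, and for $s<0$ it denotes $|s|^p\cos(\pi p)$, the real part of its principal value (the usual power when $p$ is an integer). For a measurable set $L\subset\mathbb{R}^n$ let the Gaussian dual quermassintegral be $$\widetilde V_{\gamma_n,q}(L)=\int_L e^{-|x|^2/2}|x|^{q-n}\,dx ,$$ with $dx$ Lebesgue measure, and for $h:\mathbb{S}^{n-1}\to(0,\infty)$ let $[h]=\{x\in\mathbb{R}^n:\langle x,v\rangle\le h(v)\text{ for all }v\in\mathbb{S}^{n-1}\}$ be its Wulff shape. Let $\partial'K$ be the set of boundary points $x$ of $K$ with a unique outer unit normal $\nu_K(x)$, let $\nu_K:\partial'K\to\mathbb{S}^{n-1}$ be the Gauss map, and define the $L_p$ Gaussian dual curvature measure of $K$ on Borel sets $\eta\subset\mathbb{S}^{n-1}$ by $$\widetilde C_{p,\gamma_n,q}(K,\eta)=\int_{\nu_K^{-1}(\eta)}\langle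 x,\nu_K(x)\rangle^{1-p}\,|x|^{q-n}e^{-|x|^2/2}\,d\mathcal{H}^{n-1}(x),$$ where $\mathcal{H}^{n-1}$ is the $(n-1)$-dimensional Hausdorff measure with its usual normalization. Then there is $\delta>0$ such that for every $t\in(-\delta,\delta)$ the function $h_K^p+tf^p$ is positive on $\mathbb{S}^{n-1}$ and the Wulff shape $[h_t]$ of $h_t=(h_K^p+tf^p)^{1/p}$ is a convex body containing the origin in its interior, with $\widetilde V_{\gamma_n,q}([h_t])<\infty$. Moreover $\widetilde V_{\gamma_n,q}(K)<\infty$, the function $f^p$ is integrable with respect to $\widetilde C_{p,\gamma_n,q}(K,\cdot)$, and $$\lim_{t\to0}\frac{\widetilde V_{\gamma_n,q}([h_t])-\widetilde V_{\gamma_n,q}(K)}{t}=\frac1p\int_{\mathbb{S}^{n-1}}f(v)^p\,d\widetilde C_{p,\gamma_n,q}(K,v).$$ -/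

import Mathlib

open MeasureTheory Filter Topology Set

namespace GaussDual

/-- Euclidean space `ℝⁿ`. -/
abbrev E (n : ℕ) : Type := EuclideanSpace ℝ (Fin n)

/-- The unit sphere `𝕊ⁿ⁻¹` of `ℝⁿ`. -/
abbrev S (n : ℕ) : Type := Metric.sphere (0 : E n) 1

/-- The support function `h_K(x) = max {⟨x, y⟩ : y ∈ K}`
(the supremum is attained when `K` is compact and nonempty). -/
noncomputable def supportFun {n : ℕ} (K : Set (E n)) (x : E n) : ℝ :=
  sSup ((fun y => inner ℝ x y) '' K)

/-- The Wulff shape `[h] = {x : ⟨x, v⟩ ≤ h(v) for all v ∈ 𝕊ⁿ⁻¹}`. -/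
def wulffShape {n : ℕ} (h : S n → ℝ) : Set (E n) :=
  {x | ∀ v : S n, inner ℝ x (v : E n) ≤ h v}

/-- The function `h_t = (h_K ^ p + t f ^ p) ^ (1/p)` on the sphere. -/
noncomputable def lpPerturbation {n : ℕ} (p : ℝ) (K : Set (E n)) (f : S n → ℝ) (t : ℝ) :
    S n → ℝ :=
  fun v => (supportFun K v ^ p + t * f v ^ p) ^ (1 / p)

/-- The density `e^{-|x|²/2} |x|^{q-n}` on `ℝⁿ`. -/
noncomputable def gaussKernel {n : ℕ} (q : ℝ) (x : E n) : ℝ :=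
  Real.exp (-‖x‖ ^ 2 / 2) * ‖x‖ ^ (q - n)

/-- The Gaussian dual quermassintegral `∫_K e^{-|x|²/2} |x|^{q-n} dx` (Lebesgue measure). -/
noncomputable def gaussDualQuermass {n : ℕ} (q : ℝ) (K : Set (E n)) : ℝ :=
  ∫ x in K, gaussKernel q x

/-- `v` is an outer unit normal of `K` at `x`: the point `x` lies on the supporting hyperplane
`H_K(v) = {x : ⟨x, v⟩ = h_K(v)}`. -/
def IsOuterNormal {n : ℕ} (K : Set (E n)) (x : E n) (v : S n) : Prop :=
  inner ℝ x (v : E n) = supportFun K v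

/-- The regular boundary `∂'K`: the boundary points with exactly one outer unit normal. -/
def regularBoundary {n : ℕ} (K : Set (E n)) : Set (E n) :=
  {x | x ∈ frontier K ∧ ∃! v : S n, IsOuterNormal K x v}

/-- The Gauss map `ν_K : ∂'K → 𝕊ⁿ⁻¹`. -/
noncomputable def gaussMap {n : ℕ} (K : Set (E n)) (x : regularBoundary K) : S n :=
  x.2.2.choose

/-- The measure `𝓗ⁿ⁻¹` on `∂'K`. Here `μHE[d]` is the Hausdorff measure with the usual
normalization, for which it agrees with Lebesgue measure on `ℝᵈ`. -/
noncomputable def boundaryMeasure {n : ℕ} (K : Set (E n)) : Measure (regularBoundary K) :=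
  Measure.comap Subtype.val (μHE[n - 1] : Measure (E n))

/-- The `L_p` Gaussian dual curvature measure on the sphere,
`η ↦ ∫_{ν_K⁻¹(η)} ⟨x, ν_K(x)⟩^{1-p} |x|^{q-n} e^{-|x|²/2} d𝓗ⁿ⁻¹(x)`, as the image under `ν_K`
of the measure on `∂'K` with this density; see `lpGaussDualCurvature_apply`. -/
noncomputable def lpGaussDualCurvature {n : ℕ} (p q : ℝ) (K : Set (E n)) : Measure (S n) :=
  Measure.map (gaussMap K) ((boundaryMeasure K).withDensity fun x =>
    ENNReal.ofReal (inner ℝ (x : E n) (gaussMap K x : E n) ^ (1 - p) * gaussKernel q (x : E n)))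

lemma gaussMap_spec {n : ℕ} (K : Set (E n)) (x : regularBoundary K) :
    IsOuterNormal K x (gaussMap K x) :=
  x.2.2.choose_spec.1

lemma eq_gaussMap {n : ℕ} (K : Set (E n)) (x : regularBoundary K) {v : S n}
    (hv : IsOuterNormal K x v) : v = gaussMap K x :=
  x.2.2.choose_spec.2 v hv

lemma le_supportFun {n : ℕ} {K : Set (E n)} (hK : IsCompact K) (x : E n) {y : E n} (hy : y ∈ K) :
    inner ℝ x y ≤ supportFun K x :=
  le_csSup (hK.image (by fun_prop)).bddAbove ⟨y, hy, rfl⟩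

/-- On boundary points of a compact set, being an outer normal is a closed condition. -/
lemma isOuterNormal_iff {n : ℕ} {K : Set (E n)} (hK : IsCompact K) {x : E n} (hx : x ∈ K)
    (v : S n) : IsOuterNormal K x v ↔ ∀ y ∈ K, inner ℝ (v : E n) y ≤ inner ℝ x (v : E n) := by
  unfold IsOuterNormal
  constructor
  · intro h y hy
    rw [h]
    exact le_supportFun hK _ hy
  · intro h
    apply le_antisymm
    · rw [real_inner_comm]
      exact le_supportFun hK _ hx
    · apply csSup_le (Set.Nonempty.image _ ⟨x, hx⟩)
      rintro _ ⟨y, hy, rfl⟩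
      exact h y hy

lemma isClosed_normals {n : ℕ} {K : Set (E n)} (hK : IsCompact K) :
    IsClosed {z : E n × S n | z.1 ∈ frontier K ∧ IsOuterNormal K z.1 z.2} := by
  have h : {z : E n × S n | z.1 ∈ frontier K ∧ IsOuterNormal K z.1 z.2} =
      {z | z.1 ∈ frontier K} ∩
        {z | ∀ y ∈ K, inner ℝ (z.2 : E n) y ≤ inner ℝ z.1 (z.2 : E n)} := by
    ext z
    simp only [mem_ofPred_eq, mem_inter_iff]
    exact and_congr_right fun hz => isOuterNormal_iff hK (hK.isClosed.frontier_subset hz) _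
  rw [h]
  refine (isClosed_frontier.preimage continuous_fst).inter ?_
  simp only [ofPred_forall]
  exact isClosed_iInter fun y => isClosed_iInter fun _ => isClosed_le (by fun_prop) (by fun_prop)

lemma isCompact_normals {n : ℕ} {K : Set (E n)} (hK : IsCompact K) :
    IsCompact {z : E n × S n | z.1 ∈ frontier K ∧ IsOuterNormal K z.1 z.2} :=
  (hK.prod isCompact_univ).of_isClosed_subset (isClosed_normals hK)
    fun _ hz => ⟨hK.isClosed.frontier_subset hz.1, mem_univ _⟩

lemma measurableSet_regularBoundary {n : ℕ} {K : Set (E n)} (hK : IsCompact K) :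
    MeasurableSet (regularBoundary K) := by
  set Γ := {z : E n × S n | z.1 ∈ frontier K ∧ IsOuterNormal K z.1 z.2} with hΓ
  have hc : IsCompact Γ := isCompact_normals hK
  -- pairs of normals at the same point, at distance at least `1 / (k + 1)`
  let P : ℕ → Set ((E n × S n) × (E n × S n)) := fun k =>
    (Γ ×ˢ Γ) ∩ {z | z.1.1 = z.2.1 ∧ 1 / ((k : ℝ) + 1) ≤ dist z.1.2 z.2.2}
  have hP : ∀ k, IsCompact (P k) := fun k => by
    refine (hc.prod hc).inter_right ?_
    have h1 : IsClosed {z : (E n × S n) × (E n × S n) | z.1.1 = z.2.1} :=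
      isClosed_eq (by fun_prop) (by fun_prop)
    have h2 : IsClosed {z : (E n × S n) × (E n × S n) |
        1 / ((k : ℝ) + 1) ≤ dist z.1.2 z.2.2} :=
      isClosed_le (by fun_prop) (by fun_prop)
    exact h1.inter h2
  have hEq : regularBoundary K =
      (Prod.fst '' Γ) \ ⋃ k, (fun z : (E n × S n) × (E n × S n) => z.1.1) '' P k := by
    ext x
    constructor
    · rintro ⟨hx, v, hv, huniq⟩
      refine ⟨⟨(x, v), ⟨hx, hv⟩, rfl⟩, ?_⟩
      intro hmem
      obtain ⟨k, ⟨⟨a, u⟩, ⟨b, w⟩⟩, ⟨⟨h1, h2⟩, h3, h4⟩, h5⟩ := mem_iUnion.1 hmem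
      simp only at h1 h2 h3 h4 h5
      subst h5
      subst h3
      rw [huniq u h1.2, huniq w h2.2, dist_self] at h4
      have : (0 : ℝ) < 1 / ((k : ℝ) + 1) := by positivity
      linarith
    · rintro ⟨⟨⟨a, v⟩, ⟨ha, hv⟩, h⟩, hnot⟩
      simp only at h ha hv
      subst h
      refine ⟨ha, v, hv, fun w hw => ?_⟩
      by_contra hne
      apply hnot
      obtain ⟨k, hk⟩ := exists_nat_one_div_lt (dist_pos.2 hne)
      exact mem_iUnion.2 ⟨k, ((a, w), (a, v)), ⟨⟨⟨ha, hw⟩, ⟨ha, hv⟩⟩, rfl, hk.le⟩, rfl⟩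
  rw [hEq]
  refine (hc.image continuous_fst).measurableSet.diff (MeasurableSet.iUnion fun k => ?_)
  exact ((hP k).image (by fun_prop)).measurableSet

lemma measurable_gaussMap {n : ℕ} {K : Set (E n)} (hK : IsCompact K) :
    Measurable (gaussMap K) := by
  refine measurable_of_isClosed fun C hC => ?_
  have hc : IsCompact ({z : E n × S n | z.1 ∈ frontier K ∧ IsOuterNormal K z.1 z.2} ∩
      Prod.snd ⁻¹' C) := (isCompact_normals hK).inter_right (hC.preimage continuous_snd)
  have h : gaussMap K ⁻¹' C = Subtype.val ⁻¹' (Prod.fst ''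
      ({z : E n × S n | z.1 ∈ frontier K ∧ IsOuterNormal K z.1 z.2} ∩ Prod.snd ⁻¹' C)) := by
    ext x
    constructor
    · intro hx
      exact ⟨(x, gaussMap K x), ⟨⟨x.2.1, gaussMap_spec K x⟩, hx⟩, rfl⟩
    · rintro ⟨⟨a, v⟩, ⟨⟨_, hv⟩, hvC⟩, h⟩
      simp only at h hv
      subst h
      have := eq_gaussMap K x hv
      subst this
      exact hvC
  rw [h]
  exact measurable_subtype_coe (hc.image continuous_fst).measurableSet

/-- The defining formula of the `L_p` Gaussian dual curvature measure on Borel sets. -/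
theorem lpGaussDualCurvature_apply {n : ℕ} (p q : ℝ) (K : ConvexBody (E n)) {η : Set (S n)}
    (hη : MeasurableSet η) :
    lpGaussDualCurvature p q (K : Set (E n)) η =
      ∫⁻ x in gaussMap (K : Set (E n)) ⁻¹' η,
        ENNReal.ofReal (inner ℝ (x : E n) (gaussMap (K : Set (E n)) x : E n) ^ (1 - p) *
          gaussKernel q (x : E n)) ∂(boundaryMeasure (K : Set (E n))) := by
  have hm := measurable_gaussMap K.isCompact
  rw [lpGaussDualCurvature, Measure.map_apply hm hη, withDensity_apply _ (hm hη)]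

/-- On Borel sets of `∂'K` the measure `boundaryMeasure K` is `𝓗ⁿ⁻¹`. -/
theorem boundaryMeasure_apply {n : ℕ} (K : ConvexBody (E n))
    (s : Set (regularBoundary (K : Set (E n)))) :
    boundaryMeasure (K : Set (E n)) s = μHE[n - 1] (Subtype.val '' s) :=
  (MeasurableEmbedding.subtype_coe
    (measurableSet_regularBoundary K.isCompact)).comap_apply _ s

end GaussDual

/-! In polar coordinates the quermassintegral of a convex body `L` around the origin is `∫ G(ρ_L(u))
du` over the sphere, with `G(x) = ∫₀ˣ e^{-r²/2} r^{q-1} dr` and `ρ_L = 1 / gauge L` the radial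
function (`gaussDualQuermass_eq`). So only the radial function of `[h_t]` has to be differentiated.

The constraints defining a Wulff shape give `gauge [h_t] u ^ p = max_v ⟨u,v⟩₊^p / (h_K(v)^p + t
f(v)^p)` (`gauge_rpow_le_iff`). Writing this as `J(t) = max_v B(v) / (1 + t r(v))` with `B =
⟨u,·⟩₊^p / h_K^p` and `r = f^p / h_K^p`, the derivative at `0` is `-J(0) r(v₁)` whenever the
maximiser `v₁` at `t = 0` is unique (`hasDerivAt_envelope`). A maximiser is an outer normal of `K`
at `ρ_K(u) u`, so uniqueness means that this point is regular. The gauge is Lipschitz and hence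
differentiable almost everywhere by Rademacher, and differentiability forces a unique normal; thus
almost every `u` is good. A Lipschitz bound for `J`, uniform in `u` (`abs_envelope_sub_le`), allows
differentiation under the integral, and the result is `(1/p) ∫ e^{-ρ²/2} ρ^q h_K(ν)^{-p} f(ν)^p du`.

It remains to recognise the curvature measure. The measure `ρ_K(u)^n du`, pushed to the boundary,
assigns to `A` the value `n` times the volume of the cone over `A`, and must be shown to equal `⟨x,
ν_K(x)⟩ d𝓗ⁿ⁻¹` (`radialMeasure_eq`). Where the gradient of the gauge is nearly constant, an almost
isometric homogeneous map flattens the cone to a pyramid, whose volume is base times height over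
`n`; countably many such pieces cover, and the distortion tends to `1` (`cone_measure_eq`).

Of the power `f^p` only its continuity matters, so the sign of `f` plays no role. -/

namespace GaussDual

/-! ### Support functions, Wulff shapes, gauges and outer normals. -/

section ConvexGeometry

variable {n : ℕ}

lemma nonempty_sphere (hn : 1 ≤ n) : Nonempty (S n) := by
  have : Nonempty (Fin n) := ⟨⟨0, hn⟩⟩
  have : Nontrivial (E n) := inferInstance
  exact (NormedSpace.sphere_nonempty.2 zero_le_one).to_subtype

lemma norm_sphere (v : S n) : ‖(v : E n)‖ = 1 := norm_eq_of_mem_sphere v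

lemma abs_inner_sphere_le (x : E n) (v : S n) : |inner ℝ x (v : E n)| ≤ ‖x‖ := by
  simpa [norm_sphere] using abs_real_inner_le_norm x (v : E n)

lemma inner_sphere_le (x : E n) (v : S n) : inner ℝ x (v : E n) ≤ ‖x‖ :=
  (le_abs_self _).trans (abs_inner_sphere_le x v)

lemma exists_sphere_smul {y : E n} (hy : y ≠ 0) : ∃ v : S n, y = ‖y‖ • (v : E n) := by
  have h : ‖y‖ ≠ 0 := norm_ne_zero_iff.2 hy
  refine ⟨⟨‖y‖⁻¹ • y, ?_⟩, ?_⟩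
  · simp [norm_smul, h]
  · simp [smul_smul, h]

lemma continuous_supportFun {K : Set (E n)} (hK : IsCompact K) (hne : K.Nonempty) :
    Continuous (supportFun K) := by
  obtain ⟨R, hR⟩ := hK.isBounded.exists_norm_le
  have key : ∀ x y : E n, supportFun K x ≤ supportFun K y + R * ‖x - y‖ := by
    intro x y
    refine csSup_le (hne.image _) ?_
    rintro _ ⟨z, hz, rfl⟩
    have h1 := le_supportFun hK y hz
    have h2 : inner ℝ (x - y) z ≤ ‖x - y‖ * ‖z‖ := real_inner_le_norm _ _
    have h3 : ‖x - y‖ * ‖z‖ ≤ ‖x - y‖ * R := by gcongr; exact hR z hz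
    rw [inner_sub_left] at h2
    simp only
    linarith
  obtain ⟨z, hz⟩ := hne
  have hR0 : 0 ≤ R := (norm_nonneg z).trans (hR z hz)
  refine (LipschitzWith.of_dist_le_mul (K := R.toNNReal) fun x y => ?_).continuous
  rw [Real.dist_eq, dist_eq_norm, Real.coe_toNNReal _ hR0, abs_le]
  have h1 := key x y
  have h2 := key y x
  rw [norm_sub_rev] at h2
  constructor <;> linarith

lemma exists_closedBall_subset {K : Set (E n)} (h0 : (0 : E n) ∈ interior K) :
    ∃ m : ℝ, 0 < m ∧ Metric.closedBall 0 m ⊆ K :=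
  Metric.nhds_basis_closedBall.mem_iff.1 (mem_interior_iff_mem_nhds.1 h0)

lemma exists_le_supportFun {K : Set (E n)} (hK : IsCompact K) (h0 : (0 : E n) ∈ interior K) :
    ∃ m : ℝ, 0 < m ∧ ∀ v : S n, m ≤ supportFun K v := by
  obtain ⟨m, hm, hb⟩ := exists_closedBall_subset h0
  refine ⟨m, hm, fun v => ?_⟩
  have h : m • (v : E n) ∈ K := hb (by simp [norm_smul, abs_of_pos hm])
  have := le_supportFun hK (v : E n) h
  rwa [inner_smul_right, real_inner_self_eq_norm_sq, norm_sphere, one_pow, mul_one] at this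

lemma supportFun_pos {K : Set (E n)} (hK : IsCompact K) (h0 : (0 : E n) ∈ interior K) (v : S n) :
    0 < supportFun K v := by
  obtain ⟨m, hm, h⟩ := exists_le_supportFun hK h0
  exact hm.trans_le (h v)

lemma wulffShape_eq_iInter (h : S n → ℝ) :
    wulffShape h = ⋂ v : S n, {x : E n | inner ℝ x (v : E n) ≤ h v} := by
  ext x; simp [wulffShape]

lemma isClosed_wulffShape (h : S n → ℝ) : IsClosed (wulffShape h) := by
  rw [wulffShape_eq_iInter]
  exact isClosed_iInter fun v => isClosed_le (by fun_prop) continuous_const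

lemma convex_wulffShape (h : S n → ℝ) : Convex ℝ (wulffShape h) := by
  intro x hx y hy a b ha hb hab v
  rw [inner_add_left, real_inner_smul_left, real_inner_smul_left]
  calc a * inner ℝ x (v : E n) + b * inner ℝ y (v : E n) ≤ a * h v + b * h v := by
        gcongr
        · exact hx v
        · exact hy v
    _ = h v := by rw [← add_mul, hab, one_mul]

lemma wulffShape_subset_closedBall {h : S n → ℝ} {M : ℝ} (hM0 : 0 ≤ M) (hM : ∀ v, h v ≤ M) :
    wulffShape h ⊆ Metric.closedBall 0 M := by
  intro y hy
  rw [mem_closedBall_zero_iff]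
  by_cases h0 : y = 0
  · simpa [h0] using hM0
  obtain ⟨v, hv⟩ := exists_sphere_smul h0
  have h1 := (hy v).trans (hM v)
  rw [hv, real_inner_smul_left, real_inner_self_eq_norm_sq, norm_sphere] at h1
  simpa using h1

lemma closedBall_subset_wulffShape {h : S n → ℝ} {m : ℝ} (hm : ∀ v, m ≤ h v) :
    Metric.closedBall 0 m ⊆ wulffShape h := by
  intro y hy v
  rw [mem_closedBall_zero_iff] at hy
  exact (inner_sphere_le y v).trans (hy.trans (hm v))

lemma zero_mem_interior_wulffShape {h : S n → ℝ} {m : ℝ} (hm0 : 0 < m) (hm : ∀ v, m ≤ h v) :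
    (0 : E n) ∈ interior (wulffShape h) :=
  mem_interior_iff_mem_nhds.2 <|
    mem_of_superset (Metric.closedBall_mem_nhds 0 hm0) (closedBall_subset_wulffShape hm)

lemma isCompact_wulffShape {h : S n → ℝ} {M : ℝ} (hM0 : 0 ≤ M) (hM : ∀ v, h v ≤ M) :
    IsCompact (wulffShape h) :=
  (isCompact_closedBall (0 : E n) M).of_isClosed_subset (isClosed_wulffShape h)
    (wulffShape_subset_closedBall hM0 hM)

/-- Hahn–Banach: a point outside `K` is separated from `K` by a functional, whose normalised dual
vector is a direction violating the constraint. -/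
lemma wulffShape_supportFun {K : Set (E n)} (hK : IsCompact K) (hc : Convex ℝ K)
    (hne : K.Nonempty) : wulffShape (fun v : S n => supportFun K v) = K := by
  apply Subset.antisymm
  · intro x hx
    by_contra hxK
    obtain ⟨φ, u, h1, h2⟩ := geometric_hahn_banach_closed_point hc hK.isClosed hxK
    set y : E n := (InnerProductSpace.toDual ℝ (E n)).symm φ with hy
    have hφ : ∀ z, φ z = inner ℝ y z := fun z => by simp [hy]
    have hy0 : y ≠ 0 := by
      rintro h
      obtain ⟨z, hz⟩ := hne
      have := h1 z hz
      rw [hφ, h, inner_zero_left] at this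
      rw [hφ, h, inner_zero_left] at h2
      linarith
    obtain ⟨v, hv⟩ := exists_sphere_smul hy0
    have hpos : 0 < ‖y‖ := norm_pos_iff.2 hy0
    have h3 : supportFun K v ≤ u / ‖y‖ := by
      refine csSup_le (hne.image _) ?_
      rintro _ ⟨z, hz, rfl⟩
      have := h1 z hz
      rw [hφ, hv, real_inner_smul_left] at this
      rw [le_div_iff₀ hpos]
      simp only
      linarith
    have h4 := (hx v).trans h3
    rw [le_div_iff₀ hpos] at h4
    rw [hφ, hv, real_inner_smul_left, real_inner_comm] at h2
    linarith
  · intro x hx v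
    rw [real_inner_comm]
    exact le_supportFun hK _ hx

/-- The gauge of a Wulff shape is governed by the constraints defining the shape. -/
lemma gauge_wulffShape_le_iff {h : S n → ℝ} (h0 : (0 : E n) ∈ interior (wulffShape h))
    {s : ℝ} (hs : 0 < s) (y : E n) :
    gauge (wulffShape h) y ≤ s ↔ ∀ v : S n, inner ℝ y (v : E n) ≤ s * h v := by
  have h1 : gauge (wulffShape h) y ≤ s ↔ gauge (wulffShape h) (s⁻¹ • y) ≤ 1 := by
    rw [gauge_smul_of_nonneg (inv_nonneg.2 hs.le), smul_eq_mul, inv_mul_le_iff₀ hs, mul_one]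
  rw [h1, gauge_le_one_iff_mem_closure (convex_wulffShape h) (mem_interior_iff_mem_nhds.1 h0),
    (isClosed_wulffShape h).closure_eq]
  refine forall_congr' fun v => ?_
  rw [real_inner_smul_left, inv_mul_le_iff₀ hs]

lemma gauge_le_iff {K : Set (E n)} (hK : IsCompact K) (hc : Convex ℝ K)
    (h0 : (0 : E n) ∈ interior K) {s : ℝ} (hs : 0 < s) (y : E n) :
    gauge K y ≤ s ↔ ∀ v : S n, inner ℝ y (v : E n) ≤ s * supportFun K v := by
  have h := wulffShape_supportFun hK hc ⟨0, interior_subset h0⟩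
  have h2 := gauge_wulffShape_le_iff (h := fun v : S n => supportFun K v) (by rwa [h]) hs y
  rwa [h] at h2

lemma gauge_pos_of_isCompact {K : Set (E n)} (hK : IsCompact K) (h0 : (0 : E n) ∈ interior K)
    {y : E n} (hy : y ≠ 0) : 0 < gauge K y :=
  (gauge_pos (absorbent_nhds_zero (mem_interior_iff_mem_nhds.1 h0))
    (NormedSpace.isVonNBounded_of_isBounded ℝ hK.isBounded)).2 hy

lemma inner_le_gauge_mul_supportFun {K : Set (E n)} (hK : IsCompact K) (hc : Convex ℝ K)
    (h0 : (0 : E n) ∈ interior K) (y : E n) (v : S n) :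
    inner ℝ y (v : E n) ≤ gauge K y * supportFun K v := by
  by_cases hy : y = 0
  · simp [hy]
  · exact (gauge_le_iff hK hc h0 (gauge_pos_of_isCompact hK h0 hy) y).1 le_rfl v

/-- Every direction has an outer unit normal. -/
lemma exists_inner_eq_gauge_mul {K : Set (E n)} (hn : 1 ≤ n) (hK : IsCompact K) (hc : Convex ℝ K)
    (h0 : (0 : E n) ∈ interior K) {y : E n} (hy : y ≠ 0) :
    ∃ v : S n, inner ℝ y (v : E n) = gauge K y * supportFun K v := by
  have := nonempty_sphere hn
  have hcont : Continuous fun v : S n => supportFun K (v : E n) :=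
    (continuous_supportFun hK ⟨0, interior_subset h0⟩).comp continuous_subtype_val
  have hpos := fun v => supportFun_pos hK h0 v
  have hq : Continuous fun v : S n => inner ℝ y (v : E n) / supportFun K (v : E n) :=
    Continuous.div (by fun_prop) hcont fun v => (hpos v).ne'
  -- The gauge is the maximum of `⟨y,v⟩ / h_K(v)` over the sphere, so a maximiser is the desired
  -- normal.
  obtain ⟨v, hv⟩ := isCompact_univ.exists_isMaxOn univ_nonempty hq.continuousOn
  have hv' : ∀ u : S n, inner ℝ y (u : E n) / supportFun K (u : E n) ≤
    inner ℝ y (v : E n) / supportFun K (v : E n) := fun u => hv.2 (mem_univ u)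
  refine ⟨v, le_antisymm (inner_le_gauge_mul_supportFun hK hc h0 y v) ?_⟩
  rw [← le_div_iff₀ (hpos v)]
  -- Positivity, required by `gauge_le_iff`, is seen by testing the direction of `y` itself.
  have hs : 0 < inner ℝ y (v : E n) / supportFun K (v : E n) := by
    obtain ⟨u, hu⟩ := exists_sphere_smul hy
    refine lt_of_lt_of_le (div_pos ?_ (hpos u)) (hv' u)
    rw [hu, real_inner_smul_left, real_inner_self_eq_norm_sq, norm_sphere]
    simpa using hy
  rw [gauge_le_iff hK hc h0 hs]
  intro u
  rw [← div_le_iff₀ (hpos u)]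
  exact hv' u

/-- The gradient of the gauge at a boundary point with outer normal `v`. -/
noncomputable def polarNormal (x : E n) (v : S n) : E n := (inner ℝ x (v : E n))⁻¹ • (v : E n)

/-- Since `⟨x,v⟩ = h_K(v) > 0`, passing to the gradient loses no information: equal gradients force
equal unit normals. -/
lemma smul_polarNormal {K : Set (E n)} (hK : IsCompact K) (h0 : (0 : E n) ∈ interior K) {x : E n}
    {v : S n} (hv : IsOuterNormal K x v) : ‖polarNormal x v‖⁻¹ • polarNormal x v = (v : E n) := by
  have hp : 0 < inner ℝ x (v : E n) := by
    rw [show inner ℝ x (v : E n) = supportFun K v from hv]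
    exact supportFun_pos hK h0 v
  rw [polarNormal, norm_smul, norm_sphere, mul_one, norm_inv, Real.norm_of_nonneg hp.le, inv_inv,
    smul_smul, mul_inv_cancel₀ hp.ne', one_smul]

/-- `w` is a subgradient of the gauge of `K` at `x`. -/
structure IsSubgradient (K : Set (E n)) (x w : E n) : Prop where
  inner_le : ∀ z, inner ℝ z w ≤ gauge K z
  inner_eq : inner ℝ x w = gauge K x

lemma isSubgradient_polarNormal {K : Set (E n)} (hK : IsCompact K) (hc : Convex ℝ K)
    (h0 : (0 : E n) ∈ interior K) {x : E n} (hx : gauge K x = 1) {v : S n}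
    (hv : IsOuterNormal K x v) : IsSubgradient K x (polarNormal x v) := by
  have hp := supportFun_pos hK h0 v
  unfold IsOuterNormal at hv
  constructor
  · intro z
    rw [polarNormal, inner_smul_right, hv, inv_mul_le_iff₀ hp, mul_comm]
    exact inner_le_gauge_mul_supportFun hK hc h0 z v
  · rw [polarNormal, inner_smul_right, hv, inv_mul_cancel₀ hp.ne', hx]

lemma IsSubgradient.smul {K : Set (E n)} {x w : E n} (h : IsSubgradient K x w) {r : ℝ}
    (hr : 0 ≤ r) : IsSubgradient K (r • x) w :=
  ⟨h.inner_le, by rw [real_inner_smul_left, h.inner_eq, gauge_smul_of_nonneg hr, smul_eq_mul]⟩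

/-- The difference between the gauge and the linear function `⟨·,w⟩` has a global minimum at `x`, so
its derivative vanishes there. -/
lemma IsSubgradient.fderiv_eq {K : Set (E n)} {x w : E n} (h : IsSubgradient K x w)
    (hd : DifferentiableAt ℝ (gauge K) x) : innerSL ℝ w = fderiv ℝ (gauge K) x := by
  have h1 : IsLocalMin (fun z => gauge K z - innerSL ℝ w z) x := by
    refine Eventually.of_forall fun z => ?_
    simp only [innerSL_apply_apply]
    rw [real_inner_comm, h.inner_eq, sub_self, sub_nonneg, real_inner_comm]
    exact h.inner_le z
  have h2 := h1.hasFDerivAt_eq_zero (hd.hasFDerivAt.sub (innerSL ℝ w).hasFDerivAt)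
  exact (sub_eq_zero.1 h2).symm

lemma gauge_eq_one_iff {K : Set (E n)} (hc : Convex ℝ K) (h0 : (0 : E n) ∈ interior K) {x : E n} :
    gauge K x = 1 ↔ x ∈ frontier K :=
  gauge_eq_one_iff_mem_frontier hc (mem_interior_iff_mem_nhds.1 h0)

lemma gauge_inv_smul {K : Set (E n)} (hK : IsCompact K) (h0 : (0 : E n) ∈ interior K) {y : E n}
    (hy : y ≠ 0) : gauge K ((gauge K y)⁻¹ • y) = 1 := by
  have h := gauge_pos_of_isCompact hK h0 hy
  rw [gauge_smul_of_nonneg (inv_nonneg.2 h.le), smul_eq_mul, inv_mul_cancel₀ h.ne']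

lemma isOuterNormal_inv_smul_iff {K : Set (E n)} (hK : IsCompact K) (h0 : (0 : E n) ∈ interior K)
    {y : E n} (hy : y ≠ 0) {v : S n} :
    IsOuterNormal K ((gauge K y)⁻¹ • y) v ↔ inner ℝ y (v : E n) = gauge K y * supportFun K v := by
  have h := gauge_pos_of_isCompact hK h0 hy
  rw [IsOuterNormal, real_inner_smul_left, inv_mul_eq_iff_eq_mul₀ h.ne']

/-- Each outer normal at the boundary point produces a subgradient there, which by homogeneity is
also one at `y`. Differentiability leaves room for only one. -/
lemma mem_regularBoundary_of_differentiableAt {K : Set (E n)} (hn : 1 ≤ n) (hK : IsCompact K)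
    (hc : Convex ℝ K) (h0 : (0 : E n) ∈ interior K) {y : E n} (hy : y ≠ 0)
    (hd : DifferentiableAt ℝ (gauge K) y) : (gauge K y)⁻¹ • y ∈ regularBoundary K := by
  have hg := gauge_pos_of_isCompact hK h0 hy
  have h1 := gauge_inv_smul hK h0 hy
  set x := (gauge K y)⁻¹ • y with hx
  have hyx : y = gauge K y • x := by rw [hx, smul_smul, mul_inv_cancel₀ hg.ne', one_smul]
  refine ⟨(gauge_eq_one_iff hc h0).1 h1, ?_⟩
  obtain ⟨v, hv⟩ := exists_inner_eq_gauge_mul hn hK hc h0 hy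
  have hv' : IsOuterNormal K x v := (isOuterNormal_inv_smul_iff hK h0 hy).2 hv
  refine ⟨v, hv', fun u hu => ?_⟩
  have key : ∀ u : S n, IsOuterNormal K x u →
      innerSL ℝ (polarNormal x u) = fderiv ℝ (gauge K) y := fun u hu => by
    have := (isSubgradient_polarNormal hK hc h0 h1 hu).smul hg.le
    rw [← hyx] at this
    exact this.fderiv_eq hd
  have heq : polarNormal x u = polarNormal x v := by
    refine ext_inner_right ℝ fun z => ?_
    have := DFunLike.congr_fun ((key u hu).trans (key v hv').symm) z
    simpa only [innerSL_apply_apply] using this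
  exact Subtype.ext (by
    rw [← smul_polarNormal hK h0 hu, ← smul_polarNormal hK h0 hv', heq])

end ConvexGeometry

/-! ### Volumes of cones over pieces of the boundary. -/

section ConeMeasure

open scoped Pointwise NNReal ENNReal

variable {n : ℕ}

lemma lintegral_Ioo_zero_one_pow (k : ℕ) :
    ∫⁻ x in Ioo (0 : ℝ) 1, ENNReal.ofReal (x ^ k) = ENNReal.ofReal (1 / ((k : ℝ) + 1)) := by
  rw [Measure.restrict_congr_set Ioo_ae_eq_Ioc, ← ofReal_integral_eq_lintegral_ofReal,
    ← intervalIntegral.integral_of_le zero_le_one]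
  · simp
  · exact (intervalIntegral.intervalIntegrable_pow k).1
  · filter_upwards [ae_restrict_mem measurableSet_Ioc] with y hy
    exact pow_nonneg hy.1.le _

/-- Volume of the pyramid over a subset of the hyperplane `⟨z, w⟩ = 1`. -/
lemma volume_cone_of_subset_hyperplane (hn : 1 ≤ n) {w : E n} (hw : w ≠ 0) {B : Set (E n)}
    (hB : MeasurableSet B) (hBw : ∀ z ∈ B, inner ℝ z w = (1 : ℝ)) :
    n * volume (Ioo (0 : ℝ) 1 • B) = ENNReal.ofReal ‖w‖⁻¹ * μHE[n - 1] B := by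
  have hwn : ‖w‖ ≠ 0 := norm_ne_zero_iff.2 hw
  -- The foot of the perpendicular from the origin to the hyperplane `⟨z,w⟩ = 1`; its length `‖w‖⁻¹`
  -- is the height of the pyramid.
  set a : E n := (‖w‖ ^ 2)⁻¹ • w with ha
  have ha0 : a ≠ 0 := by
    rw [ha]; exact smul_ne_zero (inv_ne_zero (pow_ne_zero _ hwn)) hw
  have hna : ‖a‖ = ‖w‖⁻¹ := by
    rw [ha, norm_smul, norm_inv, norm_pow, norm_norm]
    field_simp
  have haw : inner ℝ a w = (1 : ℝ) := by
    rw [ha, real_inner_smul_left, real_inner_self_eq_norm_sq]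
    field_simp
  have hcone : Ioo (0 : ℝ) 1 • B =
      {y : E n | inner ℝ y w ∈ Ioo (0 : ℝ) 1} ∩ (fun y : E n => (inner ℝ y w : ℝ)⁻¹ • y) ⁻¹' B := by
    ext y
    constructor
    · rintro ⟨r, hr, b, hb, rfl⟩
      have : inner ℝ (r • b) w = r := by rw [real_inner_smul_left, hBw b hb, mul_one]
      simp only [mem_inter_iff, mem_ofPred_eq, mem_preimage, this]
      exact ⟨hr, by rwa [smul_smul, inv_mul_cancel₀ hr.1.ne', one_smul]⟩
    · rintro ⟨h1, h2⟩
      refine ⟨inner ℝ y w, h1, _, h2, ?_⟩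
      simp only [smul_smul]
      rw [mul_inv_cancel₀ h1.1.ne', one_smul]
  have hmeas : MeasurableSet (Ioo (0 : ℝ) 1 • B) := by
    rw [hcone]
    have h1 : Measurable fun y : E n => (inner ℝ y w : ℝ) := by fun_prop
    exact (h1 measurableSet_Ioo).inter ((h1.inv.smul measurable_id) hB)
  -- Slicing orthogonally to `a`: at height `x • a` the cone is a copy of the base scaled by `x`, so
  -- its measure scales by `x^(n-1)`, and `∫₀¹ x^(n-1) dx = 1/n`.
  have hslice : ∀ x : ℝ, Ioo (0 : ℝ) 1 • B ∩
      (AffineSubspace.mk' (x • a +ᵥ (0 : E n)) (Submodule.span ℝ {a})ᗮ : Set (E n)) =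
      if x ∈ Ioo (0 : ℝ) 1 then x • B else ∅ := by
    intro x
    have hmem : ∀ z : E n, z ∈ AffineSubspace.mk' (x • a +ᵥ (0 : E n)) (Submodule.span ℝ {a})ᗮ ↔
        inner ℝ z w = x := by
      intro z
      rw [AffineSubspace.mem_mk', Submodule.mem_orthogonal_singleton_iff_inner_left]
      simp only [vadd_eq_add, add_zero, vsub_eq_sub]
      rw [ha, inner_smul_right, inner_sub_left, ← ha, real_inner_smul_left, haw, mul_one,
        mul_eq_zero, sub_eq_zero]
      simp [hw]
    ext z
    simp only [mem_inter_iff, SetLike.mem_coe, hmem]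
    split_ifs with hx
    · constructor
      · rintro ⟨⟨r, hr, b, hb, rfl⟩, h⟩
        simp only [real_inner_smul_left, hBw b hb, mul_one] at h
        subst h
        exact smul_mem_smul_set hb
      · rintro ⟨b, hb, rfl⟩
        exact ⟨⟨x, hx, b, hb, rfl⟩, by simp [real_inner_smul_left, hBw b hb]⟩
    · simp only [mem_empty_iff_false, iff_false, not_and]
      rintro ⟨r, hr, b, hb, rfl⟩ h
      simp only [real_inner_smul_left, hBw b hb, mul_one] at h
      exact hx (h ▸ hr)
  have hfub := EuclideanGeometry.euclideanHausdorffMeasure_eq_lintegral (0 : E n) ha0 hmeas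
  rw [InnerProductSpace.euclideanHausdorffMeasure_eq_volume, finrank_euclideanSpace_fin] at hfub
  have hint : ∀ x : ℝ, μHE[n - 1] (Ioo (0 : ℝ) 1 • B ∩
      (AffineSubspace.mk' (x • a +ᵥ (0 : E n)) (Submodule.span ℝ {a})ᗮ : Set (E n))) =
      (Ioo (0 : ℝ) 1).indicator (fun x => ENNReal.ofReal (x ^ (n - 1)) * μHE[n - 1] B) x := by
    intro x
    rw [hslice, indicator]
    split_ifs with hx
    · rw [Measure.euclideanHausdorffMeasure_smul₀ _ hx.1.ne', ENNReal.smul_def, smul_eq_mul]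
      congr 1
      rw [ENNReal.coe_pow, ENNReal.ofReal_pow hx.1.le, ← Real.enorm_of_nonneg hx.1.le]
      rfl
    · simp
  simp_rw [hint] at hfub
  rw [hfub, lintegral_indicator measurableSet_Ioo, lintegral_mul_const _ (by fun_prop),
    lintegral_Ioo_zero_one_pow, ← ofReal_norm, hna]
  have hnn : ((n - 1 : ℕ) : ℝ) + 1 = n := by
    rw [Nat.cast_sub hn]; simp
  rw [hnn]
  have h1 : (n : ℝ≥0∞) * ENNReal.ofReal (1 / n) = 1 := by
    rw [← ENNReal.ofReal_natCast, ← ENNReal.ofReal_mul (by positivity), mul_one_div_cancel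
      (by positivity), ENNReal.ofReal_one]
  calc (n : ℝ≥0∞) * (ENNReal.ofReal ‖w‖⁻¹ * (ENNReal.ofReal (1 / n) * μHE[n - 1] B))
      = ((n : ℝ≥0∞) * ENNReal.ofReal (1 / n)) * (ENNReal.ofReal ‖w‖⁻¹ * μHE[n - 1] B) := by ring
    _ = _ := by rw [h1, one_mul]

lemma euclideanHausdorffMeasure_image_le_of_lipschitzOnWith {X Y : Type*} [MetricSpace X]
    [MeasurableSpace X] [BorelSpace X] [MetricSpace Y] [MeasurableSpace Y] [BorelSpace Y]
    {f : X → Y} {c : ℝ≥0} {s : Set X} (hf : LipschitzOnWith c f s) (d : ℕ) :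
    μHE[d] (f '' s) ≤ (c : ℝ≥0∞) ^ d * μHE[d] s := by
  simp only [Measure.euclideanHausdorffMeasure_def, Measure.smul_apply, ENNReal.smul_def,
    smul_eq_mul]
  rw [mul_left_comm]
  gcongr
  simpa using hf.hausdorffMeasure_image_le (d := d) (by positivity)

/-- The hypothesis makes `f` injective on `s` with a `c`-Lipschitz inverse, to which the previous
bound applies. -/
lemma euclideanHausdorffMeasure_le_of_dist_le {X Y : Type*} [MetricSpace X]
    [MeasurableSpace X] [BorelSpace X] [MetricSpace Y] [MeasurableSpace Y] [BorelSpace Y]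
    {f : X → Y} {c : ℝ≥0} {s : Set X} (hf : ∀ x ∈ s, ∀ y ∈ s, dist x y ≤ c * dist (f x) (f y))
    (d : ℕ) : μHE[d] s ≤ (c : ℝ≥0∞) ^ d * μHE[d] (f '' s) := by
  rcases s.eq_empty_or_nonempty with rfl | ⟨x0, hx0⟩
  · simp
  have : Nonempty X := ⟨x0⟩
  have hinj : InjOn f s := fun x hx y hy h => by
    have := hf x hx y hy
    rw [h, dist_self, mul_zero] at this
    exact dist_le_zero.1 this
  have hL : LipschitzOnWith c (Function.invFunOn f s) (f '' s) := by
    refine LipschitzOnWith.of_dist_le_mul ?_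
    rintro _ ⟨x, hx, rfl⟩ _ ⟨y, hy, rfl⟩
    rw [hinj.leftInvOn_invFunOn hx, hinj.leftInvOn_invFunOn hy]
    exact hf x hx y hy
  have h := euclideanHausdorffMeasure_image_le_of_lipschitzOnWith hL d
  rwa [hinj.leftInvOn_invFunOn.image_image] at h

/-- On a piece of the boundary where the gradient of the gauge is almost constant, the volume of
the cone is almost that of a flat pyramid. -/
lemma volume_cone_comparison (hn : 1 ≤ n) {K A : Set (E n)} (hc : Convex ℝ K)
    (h0 : (0 : E n) ∈ interior K) (hA : MeasurableSet A) (hA1 : ∀ x ∈ A, gauge K x = 1)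
    {w : E n → E n} (hw : ∀ x ∈ A, IsSubgradient K x (w x)) {w₀ : E n} (hw₀ : w₀ ≠ 0) {δ : ℝ}
    {c : ℝ≥0} (hδ : ∀ x ∈ A, ‖w x - w₀‖ ≤ δ) (hc1 : 1 + δ / ‖w₀‖ ≤ c)
    (hc2 : 1 ≤ c * (1 - δ / ‖w₀‖)) :
    n * volume (Ioo (0 : ℝ) 1 • A) ≤
        (c : ℝ≥0∞) ^ (n + (n - 1)) * (ENNReal.ofReal ‖w₀‖⁻¹ * μHE[n - 1] A) ∧
      ENNReal.ofReal ‖w₀‖⁻¹ * μHE[n - 1] A ≤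
        (c : ℝ≥0∞) ^ (n + (n - 1)) * (n * volume (Ioo (0 : ℝ) 1 • A)) := by
  have hwn : 0 < ‖w₀‖ := norm_pos_iff.2 hw₀
  set a : E n := (‖w₀‖ ^ 2)⁻¹ • w₀ with ha
  have hna : ‖a‖ = ‖w₀‖⁻¹ := by
    rw [ha, norm_smul, norm_inv, norm_pow, norm_norm]
    field_simp
  have haw : inner ℝ a w₀ = (1 : ℝ) := by
    rw [ha, real_inner_smul_left, real_inner_self_eq_norm_sq]
    field_simp
  -- Shear along `a` chosen so that `⟨Φ y, w₀⟩ = gauge K y`: it carries `A` into the hyperplane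
  -- `⟨z,w₀⟩ = 1` and, being positively homogeneous, cones to cones.
  let Φ : E n → E n := fun y => y + (gauge K y - inner ℝ y w₀) • a
  have hΦcont : Continuous Φ := by
    have := continuous_gauge hc (mem_interior_iff_mem_nhds.1 h0)
    fun_prop
  -- The full cone contains both `A` and the truncated cone, so one pair of distance estimates
  -- serves both dimensions `n - 1` and `n`.
  let s : Set (E n) := {y | ∃ r : ℝ, 0 ≤ r ∧ ∃ x ∈ A, y = r • x}
  have hsub : ∀ y ∈ s, ∃ u, IsSubgradient K y u ∧ ‖u - w₀‖ ≤ δ := by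
    rintro _ ⟨r, hr, x, hx, rfl⟩
    exact ⟨w x, (hw x hx).smul hr, hδ x hx⟩
  -- The subgradient inequality at `y` bounds the increment of the gauge by that of `⟨·,u⟩`, and `u`
  -- is within `δ` of `w₀`; exchanging `y` and `z` gives the reverse bound. No convexity of the
  -- piece is needed.
  have hone : ∀ y ∈ s, ∀ z ∈ s, gauge K y - gauge K z - inner ℝ (y - z) w₀ ≤ δ * ‖y - z‖ := by
    intro y hy z hz
    obtain ⟨u, hu, huδ⟩ := hsub y hy
    have h1 := hu.inner_le z
    have h2 := hu.inner_eq
    have h3 : inner ℝ (y - z) (u - w₀) ≤ ‖y - z‖ * δ :=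
      (real_inner_le_norm _ _).trans (by gcongr)
    rw [inner_sub_right, inner_sub_left (y := z) (z := u)] at h3
    linarith
  have hdiff : ∀ y ∈ s, ∀ z ∈ s, ‖Φ y - Φ z - (y - z)‖ ≤ δ / ‖w₀‖ * ‖y - z‖ := by
    intro y hy z hz
    have h1 := hone y hy z hz
    have h2 := hone z hz y hy
    rw [norm_sub_rev] at h2
    have h3 : Φ y - Φ z - (y - z) = (gauge K y - gauge K z - inner ℝ (y - z) w₀) • a := by
      simp only [Φ, inner_sub_left, sub_smul]
      abel
    rw [h3, norm_smul, hna, Real.norm_eq_abs, div_eq_mul_inv, mul_right_comm]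
    gcongr
    rw [abs_le]
    rw [inner_sub_left] at *
    constructor <;> linarith
  have hLip : ∀ y ∈ s, ∀ z ∈ s, dist (Φ y) (Φ z) ≤ c * dist y z := by
    intro y hy z hz
    have h1 := hdiff y hy z hz
    rw [dist_eq_norm, dist_eq_norm]
    have h2 : ‖Φ y - Φ z‖ ≤ ‖Φ y - Φ z - (y - z)‖ + ‖y - z‖ := by
      simpa using norm_add_le (Φ y - Φ z - (y - z)) (y - z)
    have h3 : (1 + δ / ‖w₀‖) * ‖y - z‖ ≤ c * ‖y - z‖ := by gcongr
    linarith
  have hAnti : ∀ y ∈ s, ∀ z ∈ s, dist y z ≤ c * dist (Φ y) (Φ z) := by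
    intro y hy z hz
    have h1 := hdiff y hy z hz
    rw [dist_eq_norm, dist_eq_norm]
    have h2 : ‖y - z‖ ≤ ‖Φ y - Φ z‖ + ‖Φ y - Φ z - (y - z)‖ := by
      have := norm_sub_le (Φ y - Φ z) (Φ y - Φ z - (y - z))
      simpa using this
    have h3 : (1 - δ / ‖w₀‖) * ‖y - z‖ ≤ ‖Φ y - Φ z‖ := by linarith
    calc ‖y - z‖ = 1 * ‖y - z‖ := (one_mul _).symm
      _ ≤ c * (1 - δ / ‖w₀‖) * ‖y - z‖ := by gcongr
      _ = c * ((1 - δ / ‖w₀‖) * ‖y - z‖) := by ring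
      _ ≤ c * ‖Φ y - Φ z‖ := by gcongr
  have hAs : A ⊆ s := fun x hx => ⟨1, zero_le_one, x, hx, (one_smul _ _).symm⟩
  have hCs : Ioo (0 : ℝ) 1 • A ⊆ s := by
    rintro _ ⟨r, hr, x, hx, rfl⟩
    exact ⟨r, hr.1.le, x, hx, rfl⟩
  have hinj : InjOn Φ A := fun x hx y hy h => by
    have := hAnti x (hAs hx) y (hAs hy)
    rw [h, dist_self, mul_zero] at this
    exact dist_le_zero.1 this
  have hB : MeasurableSet (Φ '' A) := hA.image_of_continuousOn_injOn hΦcont.continuousOn hinj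
  have hBw : ∀ z ∈ Φ '' A, inner ℝ z w₀ = (1 : ℝ) := by
    rintro _ ⟨x, hx, rfl⟩
    simp only [Φ, inner_add_left, real_inner_smul_left, haw, hA1 x hx]
    ring
  have hflat := volume_cone_of_subset_hyperplane hn hw₀ hB hBw
  have himage : Φ '' (Ioo (0 : ℝ) 1 • A) = Ioo (0 : ℝ) 1 • (Φ '' A) := by
    have hhom : ∀ r : ℝ, 0 ≤ r → ∀ x, Φ (r • x) = r • Φ x := by
      intro r hr x
      simp only [Φ, gauge_smul_of_nonneg hr, real_inner_smul_left, smul_add, smul_smul, smul_eq_mul]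
      congr 2
      ring
    ext y
    constructor
    · rintro ⟨_, ⟨r, hr, x, hx, rfl⟩, rfl⟩
      exact ⟨r, hr, Φ x, mem_image_of_mem _ hx, (hhom r hr.1.le x).symm⟩
    · rintro ⟨r, hr, _, ⟨x, hx, rfl⟩, rfl⟩
      exact ⟨r • x, ⟨r, hr, x, hx, rfl⟩, hhom r hr.1.le x⟩
  have hvol : (volume : Measure (E n)) = μHE[n] :=
    (EuclideanSpace.euclideanHausdorffMeasure_eq_volume n).symm
  have hA_le := euclideanHausdorffMeasure_image_le_of_lipschitzOnWith
    (LipschitzOnWith.of_dist_le_mul fun x hx y hy => hLip x (hAs hx) y (hAs hy)) (n - 1)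
  have hA_ge := euclideanHausdorffMeasure_le_of_dist_le
    (fun x hx y hy => hAnti x (hAs hx) y (hAs hy)) (n - 1)
  have hC_le := euclideanHausdorffMeasure_image_le_of_lipschitzOnWith
    (LipschitzOnWith.of_dist_le_mul fun x hx y hy => hLip x (hCs hx) y (hCs hy)) n
  have hC_ge := euclideanHausdorffMeasure_le_of_dist_le
    (fun x hx y hy => hAnti x (hCs hx) y (hCs hy)) n
  rw [← hvol, himage] at hC_le hC_ge
  constructor
  · calc n * volume (Ioo (0 : ℝ) 1 • A)
        ≤ n * ((c : ℝ≥0∞) ^ n * volume (Ioo (0 : ℝ) 1 • (Φ '' A))) := by gcongr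
      _ = (c : ℝ≥0∞) ^ n * (n * volume (Ioo (0 : ℝ) 1 • (Φ '' A))) := by ring
      _ = (c : ℝ≥0∞) ^ n * (ENNReal.ofReal ‖w₀‖⁻¹ * μHE[n - 1] (Φ '' A)) := by rw [hflat]
      _ ≤ (c : ℝ≥0∞) ^ n * (ENNReal.ofReal ‖w₀‖⁻¹ * ((c : ℝ≥0∞) ^ (n - 1) * μHE[n - 1] A)) := by
        gcongr
      _ = _ := by rw [pow_add]; ring
  · calc ENNReal.ofReal ‖w₀‖⁻¹ * μHE[n - 1] A
        ≤ ENNReal.ofReal ‖w₀‖⁻¹ * ((c : ℝ≥0∞) ^ (n - 1) * μHE[n - 1] (Φ '' A)) := by gcongr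
      _ = (c : ℝ≥0∞) ^ (n - 1) * (ENNReal.ofReal ‖w₀‖⁻¹ * μHE[n - 1] (Φ '' A)) := by ring
      _ = (c : ℝ≥0∞) ^ (n - 1) * (n * volume (Ioo (0 : ℝ) 1 • (Φ '' A))) := by rw [hflat]
      _ ≤ (c : ℝ≥0∞) ^ (n - 1) * (n * ((c : ℝ≥0∞) ^ n * volume (Ioo (0 : ℝ) 1 • A))) := by
        gcongr
      _ = _ := by rw [pow_add]; ring

end ConeMeasure

/-! ### The cone measure on the boundary and polar coordinates. -/

section RadialMeasure

open scoped Pointwise NNReal ENNReal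

variable {n : ℕ}

/-- Making the cover disjoint turns the local comparison into a global one by countable additivity.
-/
lemma measure_le_mul_of_cover {α : Type*} [MeasurableSpace α] {μ ν : Measure α}
    {R : Set α} {D : ℕ → Set α} (hD : ∀ i, MeasurableSet (D i)) (hU : ⋃ i, D i = univ) {c : ℝ≥0∞}
    (h : ∀ i, ∀ B, MeasurableSet B → B ⊆ D i → B ⊆ R → μ B ≤ c * ν B) {A : Set α}
    (hA : MeasurableSet A) (hAR : A ⊆ R) : μ A ≤ c * ν A := by
  have hdm := MeasurableSet.disjointed hD
  have hA' : A = ⋃ i, A ∩ disjointed D i := by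
    rw [← inter_iUnion, iUnion_disjointed, hU, inter_univ]
  have hpd : Pairwise (Function.onFun Disjoint fun i => A ∩ disjointed D i) :=
    (disjoint_disjointed D).mono fun i j hij => hij.mono inter_subset_right inter_subset_right
  have hm : ∀ i, MeasurableSet (A ∩ disjointed D i) := fun i => hA.inter (hdm i)
  rw [hA', measure_iUnion hpd hm, measure_iUnion hpd hm, ← ENNReal.tsum_mul_left]
  refine ENNReal.tsum_le_tsum fun i => h i _ (hm i) ?_ (inter_subset_left.trans hAR)
  exact inter_subset_right.trans (disjointed_subset D i)

/-- Let `c` decrease to `1`; the case `b = ∞` is separate because it is trivial and multiplication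
by `∞` need not be continuous. -/
lemma le_of_forall_one_lt_le_pow_mul {a b : ℝ≥0∞} (k : ℕ)
    (h : ∀ c : ℝ≥0, 1 < c → a ≤ (c : ℝ≥0∞) ^ k * b) : a ≤ b := by
  by_cases hb : b = ∞
  · simp [hb]
  have h1 : Tendsto (fun c : ℝ≥0 => (c : ℝ≥0∞) ^ k * b) (𝓝[>] 1) (𝓝 (((1 : ℝ≥0) : ℝ≥0∞) ^ k * b)) := by
    refine ENNReal.Tendsto.mul_const ?_ (Or.inr hb)
    refine Tendsto.mono_left ?_ nhdsWithin_le_nhds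
    exact ((ENNReal.continuous_pow k).comp ENNReal.continuous_coe).tendsto 1
  simp only [ENNReal.coe_one, one_pow, one_mul] at h1
  exact ge_of_tendsto h1 (by filter_upwards [self_mem_nhdsWithin] with c hc using h c hc)

/-- The cone measure on the regular boundary is `⟨x, ν⟩ d𝓗ⁿ⁻¹`. -/
lemma cone_measure_eq (hn : 1 ≤ n) {K R : Set (E n)} (hc : Convex ℝ K)
    (h0 : (0 : E n) ∈ interior K) (hR1 : ∀ x ∈ R, gauge K x = 1)
    {w : E n → E n} (hwm : Measurable w) (hw : ∀ x ∈ R, IsSubgradient K x (w x)) {b : ℝ}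
    (hb : 0 < b) (hbw : ∀ x ∈ R, b ≤ ‖w x‖) {A : Set (E n)} (hA : MeasurableSet A) (hAR : A ⊆ R)
    {μ : Measure (E n)}
    (hμ : ∀ B, MeasurableSet B → B ⊆ R → μ B = n * volume (Ioo (0 : ℝ) 1 • B)) :
    μ A = ∫⁻ x in A, ENNReal.ofReal ‖w x‖⁻¹ ∂μHE[n - 1] := by
  set ν : Measure (E n) := μHE[n - 1].withDensity fun x => ENNReal.ofReal ‖w x‖⁻¹ with hν
  have hfm : Measurable fun x => ENNReal.ofReal ‖w x‖⁻¹ := by fun_prop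
  rw [← withDensity_apply _ hA, ← hν]
  have key : ∀ c : ℝ≥0, 1 < c → ∃ δ : ℝ, 0 < δ ∧ ∀ w₀ : E n, ∀ B, MeasurableSet B →
      B ⊆ {x | dist (w x) w₀ < δ} → B ⊆ R →
      μ B ≤ (c : ℝ≥0∞) ^ (n + (n - 1) + 1) * ν B ∧
      ν B ≤ (c : ℝ≥0∞) ^ (n + (n - 1) + 1) * μ B := by
    intro c hc1
    have hc1' : (1 : ℝ) < c := by exact_mod_cast hc1
    have hc0 : (0 : ℝ) < c := by linarith
    -- With this relative error, `c * (1 - e) = 1` and `1 + e ≤ c` (as `c + c⁻¹ ≥ 2`), the two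
    -- conditions of `volume_cone_comparison`.
    set e : ℝ := 1 - (c : ℝ)⁻¹ with he
    have he0 : 0 < e := by
      rw [he, sub_pos]; exact inv_lt_one_of_one_lt₀ hc1'
    have he1 : e < 1 := by rw [he]; linarith [inv_pos.2 hc0]
    -- The radius is at most `b / 2`, so `‖w₀‖ ≥ b / 2` on a nonempty piece and the relative error
    -- is at most `e`.
    refine ⟨e * b / 2, by positivity, fun w₀ B hB hBw hBR => ?_⟩
    rcases B.eq_empty_or_nonempty with rfl | ⟨x0, hx0⟩
    · simp
    have hδ : ∀ x ∈ B, ‖w x - w₀‖ ≤ e * b / 2 := fun x hx => by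
      rw [← dist_eq_norm]; exact (hBw hx).le
    have hw₀b : b / 2 ≤ ‖w₀‖ := by
      have h1 := hδ x0 hx0
      have h2 := hbw x0 (hBR hx0)
      have h3 : ‖w x0‖ ≤ ‖w₀‖ + ‖w x0 - w₀‖ := by
        simpa using norm_add_le w₀ (w x0 - w₀)
      nlinarith
    have hw₀p : 0 < ‖w₀‖ := by linarith
    have hratio : e * b / 2 / ‖w₀‖ ≤ e := by
      rw [div_le_iff₀ hw₀p]
      nlinarith
    have hinv : (c : ℝ) * (c : ℝ)⁻¹ = 1 := mul_inv_cancel₀ hc0.ne'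
    have hci : 0 < (c : ℝ)⁻¹ := inv_pos.2 hc0
    have hcc1 : 1 + e * b / 2 / ‖w₀‖ ≤ c := by
      have : 1 + e ≤ c := by
        rw [he]
        nlinarith [mul_pos hci (pow_pos (sub_pos.2 hc1') 2)]
      linarith
    have hcc2 : 1 ≤ c * (1 - e * b / 2 / ‖w₀‖) := by
      have h1 : (c : ℝ) * (1 - e) = 1 := by rw [he]; simpa using hinv
      nlinarith
    obtain ⟨h1, h2⟩ := volume_cone_comparison hn hc h0 hB (fun x hx => hR1 x (hBR hx))
      (fun x hx => hw x (hBR hx)) (norm_pos_iff.1 hw₀p) hδ hcc1 hcc2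
    rw [← hμ B hB hBR] at h1 h2
    -- Replacing the constant height `‖w₀‖⁻¹` by `‖w x‖⁻¹` costs one more factor `c`, hence the `+
    -- 1` in the exponent.
    have h3 : ENNReal.ofReal ‖w₀‖⁻¹ * μHE[n - 1] B ≤ c * ν B := by
      rw [hν, withDensity_apply _ hB, ← lintegral_const_mul _ hfm, ← setLIntegral_const]
      refine setLIntegral_mono (hfm.const_mul _) fun x hx => ?_
      rw [← ENNReal.ofReal_coe_nnreal, ← ENNReal.ofReal_mul hc0.le]
      refine ENNReal.ofReal_le_ofReal ?_
      have hwx : 0 < ‖w x‖ := hb.trans_le (hbw x (hBR hx))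
      rw [← div_eq_mul_inv, le_div_iff₀ hwx, inv_mul_le_iff₀ hw₀p]
      have h4 : ‖w x‖ ≤ ‖w₀‖ + ‖w x - w₀‖ := by
        simpa using norm_add_le w₀ (w x - w₀)
      have h5 := hδ x hx
      have h6 : ‖w₀‖ * (1 + e * b / 2 / ‖w₀‖) ≤ ‖w₀‖ * c := by gcongr
      rw [mul_add, mul_div_cancel₀ _ hw₀p.ne'] at h6
      linarith
    have h3' : ν B ≤ c * (ENNReal.ofReal ‖w₀‖⁻¹ * μHE[n - 1] B) := by
      rw [hν, withDensity_apply _ hB, ← mul_assoc, ← setLIntegral_const]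
      refine setLIntegral_mono measurable_const fun x hx => ?_
      rw [← ENNReal.ofReal_coe_nnreal, ← ENNReal.ofReal_mul hc0.le]
      refine ENNReal.ofReal_le_ofReal ?_
      have hwx : 0 < ‖w x‖ := hb.trans_le (hbw x (hBR hx))
      rw [← div_eq_mul_inv, le_div_iff₀ hw₀p, inv_mul_le_iff₀ hwx]
      have h4 : ‖w₀‖ ≤ ‖w x‖ + ‖w x - w₀‖ := by
        have := norm_sub_le (w x) (w x - w₀)
        simpa using this
      have h5 := hδ x hx
      have h6 : ‖w₀‖ * 1 ≤ ‖w₀‖ * (c * (1 - e * b / 2 / ‖w₀‖)) := by gcongr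
      have h7 : ‖w₀‖ * (c * (1 - e * b / 2 / ‖w₀‖)) = c * (‖w₀‖ - e * b / 2) := by
        field_simp
      have h8 : c * (‖w₀‖ - e * b / 2) ≤ c * ‖w x‖ := by
        gcongr; linarith
      linarith
    constructor
    · calc μ B ≤ (c : ℝ≥0∞) ^ (n + (n - 1)) * (ENNReal.ofReal ‖w₀‖⁻¹ * μHE[n - 1] B) := h1
        _ ≤ (c : ℝ≥0∞) ^ (n + (n - 1)) * (c * ν B) := by gcongr
        _ = _ := by rw [pow_succ]; ring
    · calc ν B ≤ c * (ENNReal.ofReal ‖w₀‖⁻¹ * μHE[n - 1] B) := h3'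
        _ ≤ c * ((c : ℝ≥0∞) ^ (n + (n - 1)) * μ B) := by gcongr
        _ = _ := by rw [pow_succ]; ring
  have hcover : ∀ δ : ℝ, 0 < δ →
      (∀ i, MeasurableSet {x | dist (w x) (TopologicalSpace.denseSeq (E n) i) < δ}) ∧
      ⋃ i, {x | dist (w x) (TopologicalSpace.denseSeq (E n) i) < δ} = univ := by
    intro δ hδ
    refine ⟨fun i => measurableSet_lt (hwm.dist measurable_const) measurable_const, ?_⟩
    refine eq_univ_of_forall fun x => mem_iUnion.2 ?_
    obtain ⟨i, hi⟩ := (TopologicalSpace.denseRange_denseSeq (E n)).exists_dist_lt (w x) hδ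
    exact ⟨i, hi⟩
  apply le_antisymm <;> refine le_of_forall_one_lt_le_pow_mul (n + (n - 1) + 1) fun c hc1 => ?_
  · obtain ⟨δ, hδ, h⟩ := key c hc1
    exact measure_le_mul_of_cover (hcover δ hδ).1 (hcover δ hδ).2
      (fun i B hB hBi hBR => (h _ B hB hBi hBR).1) hA hAR
  · obtain ⟨δ, hδ, h⟩ := key c hc1
    exact measure_le_mul_of_cover (hcover δ hδ).1 (hcover δ hδ).2
      (fun i B hB hBi hBR => (h _ B hB hBi hBR).2) hA hAR

/-- Polar coordinates for nonnegative functions. -/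
lemma lintegral_polar (hn : 1 ≤ n) {F : E n → ℝ≥0∞} (hF : Measurable F) :
    ∫⁻ y, F y = ∫⁻ u : S n, ∫⁻ r : Ioi (0 : ℝ), F (r.1 • (u : E n))
      ∂(Measure.volumeIoiPow (n - 1)) ∂(volume : Measure (E n)).toSphere := by
  have h : Nonempty (Fin n) := ⟨⟨0, hn⟩⟩
  have hmp := (volume : Measure (E n)).measurePreserving_homeomorphUnitSphereProd
  rw [finrank_euclideanSpace_fin] at hmp
  have h1 : ∫⁻ y, F y = ∫⁻ y : ({0}ᶜ : Set (E n)), F (y : E n) ∂(volume.comap Subtype.val) := by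
    rw [lintegral_subtype_comap (measurableSet_singleton _).compl, restrict_compl_singleton]
  have h2 : ∀ y : ({0}ᶜ : Set (E n)), F (y : E n) =
      (fun z : S n × Ioi (0 : ℝ) => F (z.2.1 • (z.1 : E n))) (homeomorphUnitSphereProd (E n) y) := by
    intro y
    have := (homeomorphUnitSphereProd (E n)).symm_apply_apply y
    conv_lhs => rw [← this]
    simp only [homeomorphUnitSphereProd_symm_apply_coe]
  have hm : Measurable fun z : S n × Ioi (0 : ℝ) => F (z.2.1 • (z.1 : E n)) :=
    hF.comp (by fun_prop)
  simp_rw [h1, h2]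
  rw [hmp.lintegral_comp hm, lintegral_prod _ hm.aemeasurable]

/-- The radial image on the boundary of `K` of a direction. -/
noncomputable def radialMap (K : Set (E n)) (u : S n) : E n := (gauge K u)⁻¹ • (u : E n)

/-- The push-forward to the boundary of `K` of the measure `ρ_K(u)ⁿ du`. -/
noncomputable def radialMeasure (K : Set (E n)) : Measure (E n) :=
  ((volume : Measure (E n)).toSphere.withDensity
    fun u => ENNReal.ofReal ((gauge K (u : E n))⁻¹ ^ n)).map (radialMap K)

lemma sphere_ne_zero (u : S n) : (u : E n) ≠ 0 := by
  rw [← norm_ne_zero_iff, norm_sphere]; exact one_ne_zero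

lemma gauge_sphere_pos {K : Set (E n)} (hK : IsCompact K) (h0 : (0 : E n) ∈ interior K) (u : S n) :
    0 < gauge K (u : E n) := gauge_pos_of_isCompact hK h0 (sphere_ne_zero u)

lemma continuous_gauge_sphere {K : Set (E n)} (hc : Convex ℝ K) (h0 : (0 : E n) ∈ interior K) :
    Continuous fun u : S n => gauge K (u : E n) :=
  (continuous_gauge hc (mem_interior_iff_mem_nhds.1 h0)).comp continuous_subtype_val

lemma continuous_radialMap {K : Set (E n)} (hK : IsCompact K) (hc : Convex ℝ K)
    (h0 : (0 : E n) ∈ interior K) : Continuous (radialMap K) :=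
  ((continuous_gauge_sphere hc h0).inv₀ fun u => (gauge_sphere_pos hK h0 u).ne').smul
    continuous_subtype_val

/-- Polar coordinates: the ray in direction `u` meets the cone in `(0, ρ_K(u))` if `ρ_K(u) u ∈ A`
and not at all otherwise, which contributes `ρ_K(u)^n / n` or `0`. -/
lemma radialMeasure_apply (hn : 1 ≤ n) {K : Set (E n)} (hK : IsCompact K) (hc : Convex ℝ K)
    (h0 : (0 : E n) ∈ interior K) {A : Set (E n)} (hA : MeasurableSet A)
    (hA1 : ∀ x ∈ A, gauge K x = 1) :
    radialMeasure K A = n * volume (Ioo (0 : ℝ) 1 • A) := by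
  have hgc := continuous_gauge hc (mem_interior_iff_mem_nhds.1 h0)
  have hT := (continuous_radialMap hK hc h0).measurable
  have hcone : Ioo (0 : ℝ) 1 • A =
      {y : E n | gauge K y ∈ Ioo (0 : ℝ) 1} ∩ (fun y : E n => (gauge K y)⁻¹ • y) ⁻¹' A := by
    ext y
    constructor
    · rintro ⟨r, hr, b, hb, rfl⟩
      have : gauge K (r • b) = r := by
        rw [gauge_smul_of_nonneg hr.1.le, hA1 b hb, smul_eq_mul, mul_one]
      simp only [mem_inter_iff, mem_ofPred_eq, mem_preimage, this]
      exact ⟨hr, by rwa [smul_smul, inv_mul_cancel₀ hr.1.ne', one_smul]⟩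
    · rintro ⟨h1, h2⟩
      refine ⟨gauge K y, h1, _, h2, ?_⟩
      simp only [smul_smul]
      rw [mul_inv_cancel₀ h1.1.ne', one_smul]
  have hmeas : MeasurableSet (Ioo (0 : ℝ) 1 • A) := by
    rw [hcone]
    exact (hgc.measurable measurableSet_Ioo).inter
      ((hgc.measurable.inv.smul measurable_id) hA)
  have hslice : ∀ u : S n, ∫⁻ r : Ioi (0 : ℝ),
      (Ioo (0 : ℝ) 1 • A).indicator 1 (r.1 • (u : E n)) ∂(Measure.volumeIoiPow (n - 1)) =
      (radialMap K ⁻¹' A).indicator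
        (fun u => ENNReal.ofReal ((gauge K (u : E n))⁻¹ ^ n / n)) u := by
    intro u
    have hg := gauge_sphere_pos hK h0 u
    have hgi : (gauge K (u : E n))⁻¹ ∈ Ioi (0 : ℝ) := inv_pos.2 hg
    have hiff : ∀ r : Ioi (0 : ℝ), r.1 • (u : E n) ∈ Ioo (0 : ℝ) 1 • A ↔
        r ∈ {r : Ioi (0 : ℝ) | r < ⟨(gauge K (u : E n))⁻¹, hgi⟩ ∧ radialMap K u ∈ A} := by
      rintro ⟨r, hr⟩
      have hr' : 0 < r := hr
      rw [hcone]
      simp only [mem_inter_iff, mem_ofPred_eq, mem_preimage, gauge_smul_of_nonneg hr'.le,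
        smul_eq_mul, mem_Ioo, Subtype.mk_lt_mk]
      have h1 : (r * gauge K (u : E n))⁻¹ • r • (u : E n) = radialMap K u := by
        rw [smul_smul, radialMap, mul_inv, mul_comm r⁻¹, mul_assoc, inv_mul_cancel₀ hr'.ne', mul_one]
      rw [h1, lt_inv_comm₀ hr' hg, ← one_div, lt_div_iff₀ hr', mul_comm (gauge K _)]
      simp [mul_pos hr' hg]
    by_cases hu : radialMap K u ∈ A
    · have : (fun r : Ioi (0 : ℝ) => (Ioo (0 : ℝ) 1 • A).indicator (1 : E n → ℝ≥0∞)
          (r.1 • (u : E n))) = (Iio ⟨(gauge K (u : E n))⁻¹, hgi⟩).indicator 1 := by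
        ext r
        simp only [indicator, hiff, mem_ofPred_eq, hu, and_true, mem_Iio]
        rfl
      rw [this, lintegral_indicator_one measurableSet_Iio, Measure.volumeIoiPow_apply_Iio,
        indicator_of_mem (by exact hu), Nat.sub_add_cancel hn, Nat.cast_sub hn]
      simp
    · have : ∀ r : Ioi (0 : ℝ), (Ioo (0 : ℝ) 1 • A).indicator (1 : E n → ℝ≥0∞)
          (r.1 • (u : E n)) = 0 := by
        intro r
        refine indicator_of_notMem (fun h => hu ((hiff r).1 h).2) _
      simp only [this, lintegral_zero]
      rw [indicator_of_notMem (by exact hu)]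
  have hgm := (continuous_gauge_sphere hc h0).measurable
  have hvol : volume (Ioo (0 : ℝ) 1 • A) = ∫⁻ u in radialMap K ⁻¹' A,
      ENNReal.ofReal ((gauge K (u : E n))⁻¹ ^ n / n) ∂(volume : Measure (E n)).toSphere := by
    rw [← lintegral_indicator_one hmeas, lintegral_polar hn (measurable_one.indicator hmeas)]
    simp_rw [hslice]
    rw [lintegral_indicator (hT hA)]
  rw [hvol, ← lintegral_const_mul _ (by fun_prop), radialMeasure, Measure.map_apply hT hA,
    withDensity_apply _ (hT hA)]
  refine lintegral_congr fun u => ?_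
  have hn0 : (n : ℝ) ≠ 0 := by positivity
  rw [← ENNReal.ofReal_natCast, ← ENNReal.ofReal_mul (by positivity), mul_div_cancel₀ _ hn0]

end RadialMeasure

/-! ### The curvature measure in radial coordinates. -/

section CurvatureMeasure

open scoped Pointwise NNReal ENNReal

variable {n : ℕ}

lemma differentiableAt_gauge_of_smul {K : Set (E n)} {r : ℝ} (hr : 0 < r) {y : E n}
    (hd : DifferentiableAt ℝ (gauge K) (r • y)) : DifferentiableAt ℝ (gauge K) y := by
  have h : gauge K = fun z => r⁻¹ * gauge K (r • z) := by
    ext z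
    rw [gauge_smul_of_nonneg hr.le, smul_eq_mul, inv_mul_cancel_left₀ hr.ne']
  rw [h]
  exact (DifferentiableAt.comp y (g := gauge K) (f := fun z => r • z) hd (by fun_prop)).const_mul _

/-- Almost every radial direction meets the boundary at a regular point. -/
lemma ae_radialMap_mem_regularBoundary (hn : 1 ≤ n) {K : Set (E n)} (hK : IsCompact K)
    (hc : Convex ℝ K) (h0 : (0 : E n) ∈ interior K) :
    ∀ᵐ u ∂(volume : Measure (E n)).toSphere, radialMap K u ∈ regularBoundary K := by
  obtain ⟨C, hC⟩ := hc.lipschitz_gauge (mem_interior_iff_mem_nhds.1 h0)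
  have hrad := hC.ae_differentiableAt (μ := volume)
  have hm : MeasurableSet {u : S n | ¬ DifferentiableAt ℝ (gauge K) (u : E n)} :=
    (measurable_subtype_coe (measurableSet_of_differentiableAt ℝ (gauge K))).compl
  have hnull : (volume : Measure (E n)).toSphere
      {u : S n | ¬ DifferentiableAt ℝ (gauge K) (u : E n)} = 0 := by
    -- The spherical measure of a set is `n` times the volume of its cone. Differentiability is
    -- invariant under scaling, so the cone over the bad directions lies in the null set given by
    -- Rademacher.
    rw [Measure.toSphere_apply' _ hm, mul_eq_zero]
    refine Or.inr (measure_mono_null ?_ (ae_iff.1 hrad))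
    rintro _ ⟨r, hr, _, ⟨u, hu, rfl⟩, rfl⟩ hd
    exact hu (differentiableAt_gauge_of_smul hr.1 hd)
  filter_upwards [compl_mem_ae_iff.2 hnull] with u hu
  exact mem_regularBoundary_of_differentiableAt hn hK hc h0 (sphere_ne_zero u)
    (not_not.1 hu)

open Classical in
/-- A total extension of the Gauss map, with value `v₀` off the regular boundary. -/
noncomputable def gaussMapExt (K : Set (E n)) (v₀ : S n) (x : E n) : S n :=
  if h : x ∈ regularBoundary K then gaussMap K ⟨x, h⟩ else v₀

lemma gaussMapExt_coe (K : Set (E n)) (v₀ : S n) (x : regularBoundary K) :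
    gaussMapExt K v₀ x = gaussMap K x := by
  rw [gaussMapExt, dif_pos x.2]

lemma measurable_gaussMapExt {K : Set (E n)} (hK : IsCompact K) (v₀ : S n) :
    Measurable (gaussMapExt K v₀) := by
  classical
  exact Measurable.dite (measurable_gaussMap hK) measurable_const (measurableSet_regularBoundary hK)

lemma isOuterNormal_gaussMapExt {K : Set (E n)} (v₀ : S n) {x : E n}
    (hx : x ∈ regularBoundary K) : IsOuterNormal K x (gaussMapExt K v₀ x) := by
  rw [gaussMapExt, dif_pos hx]
  exact gaussMap_spec K ⟨x, hx⟩

lemma eq_gaussMapExt {K : Set (E n)} (v₀ : S n) {x : E n}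
    (hx : x ∈ regularBoundary K) {v : S n} (hv : IsOuterNormal K x v) :
    v = gaussMapExt K v₀ x := by
  rw [gaussMapExt, dif_pos hx]
  exact eq_gaussMap K ⟨x, hx⟩ hv

/-- In radial coordinates the surface measure `⟨x, ν⟩ d𝓗ⁿ⁻¹` on the boundary is `ρ_K(u)ⁿ du`. -/
lemma radialMeasure_eq (hn : 1 ≤ n) {K : Set (E n)} (hK : IsCompact K)
    (hc : Convex ℝ K) (h0 : (0 : E n) ∈ interior K) (v₀ : S n) :
    radialMeasure K = (μHE[n - 1].restrict (regularBoundary K)).withDensity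
      fun x => ENNReal.ofReal (inner ℝ x (gaussMapExt K v₀ x : E n)) := by
  have hR := measurableSet_regularBoundary hK
  have hT := (continuous_radialMap hK hc h0).measurable
  have hN := measurable_gaussMapExt hK v₀
  have hR1 : ∀ x ∈ regularBoundary K, gauge K x = 1 := fun x hx => (gauge_eq_one_iff hc h0).2 hx.1
  obtain ⟨M, hM⟩ := hK.isBounded.exists_norm_le
  have hRM : ∀ x ∈ regularBoundary K, ‖x‖ ≤ max M 1 := fun x hx =>
    (hM x (hK.isClosed.frontier_subset hx.1)).trans (le_max_left _ _)
  have hM1 : 0 < max M 1 := lt_max_of_lt_right one_pos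
  have hsub : ∀ x ∈ regularBoundary K, IsSubgradient K x (polarNormal x (gaussMapExt K v₀ x)) :=
    fun x hx => isSubgradient_polarNormal hK hc h0 (hR1 x hx) (isOuterNormal_gaussMapExt v₀ hx)
  have hw : Measurable fun x => polarNormal x (gaussMapExt K v₀ x) := by
    have h1 : Measurable fun x => (gaussMapExt K v₀ x : E n) := measurable_subtype_coe.comp hN
    exact (Measurable.inner (𝕜 := ℝ) measurable_id h1).inv.smul h1
  ext A hA
  have hAR : MeasurableSet (A ∩ regularBoundary K) := hA.inter hR
  have hae : radialMeasure K A = radialMeasure K (A ∩ regularBoundary K) := by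
    rw [radialMeasure, Measure.map_apply hT hA, Measure.map_apply hT hAR]
    refine measure_congr ?_
    have h1 : ∀ᵐ u ∂((volume : Measure (E n)).toSphere.withDensity
        fun u => ENNReal.ofReal ((gauge K (u : E n))⁻¹ ^ n)), radialMap K u ∈ regularBoundary K :=
      (withDensity_absolutelyContinuous _ _).ae_le
        (ae_radialMap_mem_regularBoundary hn hK hc h0)
    filter_upwards [h1] with u hu
    exact propext ⟨fun h => ⟨h, hu⟩, fun h => h.1⟩
  rw [hae, cone_measure_eq hn hc h0 hR1 hw hsub (inv_pos.2 hM1) ?_ hAR inter_subset_right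
    (fun B hB hBR => radialMeasure_apply hn hK hc h0 hB fun x hx => hR1 x (hBR hx)),
    withDensity_apply _ hA, Measure.restrict_restrict hA]
  · refine setLIntegral_congr_fun hAR fun x hx => ?_
    have hp : 0 < inner ℝ x (gaussMapExt K v₀ x : E n) := by
      rw [show inner ℝ x (gaussMapExt K v₀ x : E n) = _ from isOuterNormal_gaussMapExt v₀ hx.2]
      exact supportFun_pos hK h0 _
    simp only [polarNormal, norm_smul, norm_sphere, mul_one, norm_inv, inv_inv,
      Real.norm_of_nonneg hp.le]
  -- The lower bound for the gradient `w`: `1 = ⟨x,w⟩ ≤ ‖x‖ ‖w‖`, and `K` is bounded.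
  · intro x hx
    have h1 := (hsub x hx).inner_eq
    rw [hR1 x hx] at h1
    have h2 := real_inner_le_norm x (polarNormal x (gaussMapExt K v₀ x))
    rw [h1] at h2
    rw [inv_le_iff_one_le_mul₀ hM1, mul_comm]
    exact h2.trans (by gcongr; exact hRM x hx)

/-- The `L_p` Gaussian dual curvature measure in radial coordinates. -/
lemma lpGaussDualCurvature_eq_map (hn : 1 ≤ n) (p q : ℝ) {K : Set (E n)} (hK : IsCompact K)
    (hc : Convex ℝ K) (h0 : (0 : E n) ∈ interior K) (v₀ : S n) :
    lpGaussDualCurvature p q K =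
      ((volume : Measure (E n)).toSphere.withDensity fun u => ENNReal.ofReal
        (Real.exp (-(gauge K (u : E n))⁻¹ ^ 2 / 2) * (gauge K (u : E n))⁻¹ ^ q *
          supportFun K (gaussMapExt K v₀ (radialMap K u) : E n) ^ (-p))).map
        fun u => gaussMapExt K v₀ (radialMap K u) := by
  have hR := measurableSet_regularBoundary hK
  have hT := (continuous_radialMap hK hc h0).measurable
  have hN := measurable_gaussMapExt hK v₀
  have hN' : Measurable fun x => (gaussMapExt K v₀ x : E n) := measurable_subtype_coe.comp hN
  have hNT : Measurable fun u => gaussMapExt K v₀ (radialMap K u) := hN.comp hT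
  have hi : Measurable fun x : E n => inner ℝ x (gaussMapExt K v₀ x : E n) :=
    Measurable.inner measurable_id hN'
  have hk : Measurable fun x : E n => gaussKernel q x := by
    unfold gaussKernel; fun_prop
  ext η hη
  have hη' := hN hη
  -- The exponent is `-p` instead of `1 - p` because the remaining factor `⟨x,ν⟩` is the density of
  -- `radialMeasure`.
  let k : E n → ℝ≥0∞ := fun x =>
    ENNReal.ofReal (inner ℝ x (gaussMapExt K v₀ x : E n) ^ (-p) * gaussKernel q x)
  have hkm : Measurable k := by
    have : Measurable fun x : E n => inner ℝ x (gaussMapExt K v₀ x : E n) ^ (-p) :=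
      hi.pow_const _
    fun_prop
  have hgm := (continuous_gauge_sphere hc h0).measurable
  have hleft : lpGaussDualCurvature p q K η =
      ∫⁻ x in gaussMapExt K v₀ ⁻¹' η ∩ regularBoundary K,
        ENNReal.ofReal (inner ℝ x (gaussMapExt K v₀ x : E n) ^ (1 - p) * gaussKernel q x)
          ∂μHE[n - 1] := by
    have him : gaussMapExt K v₀ ⁻¹' η ∩ regularBoundary K =
        Subtype.val '' (gaussMap K ⁻¹' η) := by
      ext x
      constructor
      · rintro ⟨h1, h2⟩
        refine ⟨⟨x, h2⟩, ?_, rfl⟩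
        rw [mem_preimage, ← gaussMapExt_coe K v₀]
        exact h1
      · rintro ⟨y, hy, rfl⟩
        refine ⟨?_, y.2⟩
        rw [mem_preimage, gaussMapExt_coe]
        exact hy
    rw [him, lpGaussDualCurvature, Measure.map_apply (measurable_gaussMap hK) hη,
      withDensity_apply _ (measurable_gaussMap hK hη), boundaryMeasure, ← setLIntegral_subtype hR]
    simp_rw [gaussMapExt_coe]
  have hright : ∫⁻ u in (fun u => gaussMapExt K v₀ (radialMap K u)) ⁻¹' η, ENNReal.ofReal
        (Real.exp (-(gauge K (u : E n))⁻¹ ^ 2 / 2) * (gauge K (u : E n))⁻¹ ^ q *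
          supportFun K (gaussMapExt K v₀ (radialMap K u) : E n) ^ (-p))
          ∂(volume : Measure (E n)).toSphere =
      ∫⁻ x in gaussMapExt K v₀ ⁻¹' η, k x ∂radialMeasure K := by
    rw [radialMeasure, setLIntegral_map hη' hkm hT,
      setLIntegral_withDensity_eq_setLIntegral_mul (g := fun u => k (radialMap K u)) _
        (by fun_prop) (hkm.comp hT) (hT hη')]
    refine lintegral_congr_ae (ae_restrict_of_ae ?_)
    filter_upwards [ae_radialMap_mem_regularBoundary hn hK hc h0] with u hu
    have hg := inv_pos.2 (gauge_sphere_pos hK h0 u)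
    have hin : inner ℝ (radialMap K u) (gaussMapExt K v₀ (radialMap K u) : E n) =
        supportFun K (gaussMapExt K v₀ (radialMap K u) : E n) := isOuterNormal_gaussMapExt v₀ hu
    have hnorm : ‖radialMap K u‖ = (gauge K (u : E n))⁻¹ := by
      rw [radialMap, norm_smul, norm_sphere, mul_one, Real.norm_of_nonneg hg.le]
    simp only [Pi.mul_apply, k]
    -- The Jacobian `ρ^n` cancels against `‖x‖^(q-n) = ρ^(q-n)`, leaving `ρ^q`.
    rw [← ENNReal.ofReal_mul (by positivity), hin, gaussKernel, hnorm, Real.rpow_sub hg,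
      Real.rpow_natCast]
    generalize (gauge K (u : E n))⁻¹ = ρ at hg
    congr 1
    field_simp
  rw [Measure.map_apply hNT hη, withDensity_apply _ (hNT hη), hright, hleft,
    radialMeasure_eq hn hK hc h0 v₀,
    setLIntegral_withDensity_eq_setLIntegral_mul _ (by fun_prop) hkm hη',
    Measure.restrict_restrict hη']
  refine setLIntegral_congr_fun (hη'.inter hR) fun x hx => ?_
  have hp : 0 < inner ℝ x (gaussMapExt K v₀ x : E n) := by
    rw [show inner ℝ x (gaussMapExt K v₀ x : E n) = _ from isOuterNormal_gaussMapExt v₀ hx.2]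
    exact supportFun_pos hK h0 _
  simp only [Pi.mul_apply, k]
  rw [← ENNReal.ofReal_mul hp.le, ← mul_assoc, sub_eq_add_neg, Real.rpow_add hp, Real.rpow_one]

end CurvatureMeasure

/-! ### Derivative of a maximum depending on a parameter. -/

section Envelope

variable {X : Type*} [TopologicalSpace X] [CompactSpace X] {B r : X → ℝ} {ρ δ : ℝ} {J : ℝ → ℝ}

omit [TopologicalSpace X] [CompactSpace X] in
/-- Lipschitz bound for `J t = max_v B v / (1 + t r v)`. -/
lemma abs_envelope_sub_le (hρ : ∀ v, |r v| ≤ ρ) (hρ0 : 0 ≤ ρ) (hδ : δ * ρ ≤ 1 / 4)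
    (hJpos : ∀ t, |t| < δ → 0 < J t)
    (hJ : ∀ t, |t| < δ → ∀ s, 0 < s → (J t ≤ s ↔ ∀ v, B v ≤ s * (1 + t * r v)))
    {t : ℝ} (ht : |t| < δ) : |J t - J 0| ≤ 2 * J 0 * ρ * |t| := by
  have h00 : |(0 : ℝ)| < δ := by
    rw [abs_zero]; exact (abs_nonneg t).trans_lt ht
  have hJ0 := hJpos 0 h00
  have hJt := hJpos t ht
  have hB0 : ∀ v, B v ≤ J 0 := fun v => by
    simpa using (hJ 0 h00 _ hJ0).1 le_rfl v
  have hBt := (hJ t ht _ hJt).1 le_rfl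
  have habs := abs_nonneg t
  have htρ : |t| * ρ ≤ 1 / 4 := le_trans (by gcongr) hδ
  have htρ0 : 0 ≤ |t| * ρ := by positivity
  have htr : ∀ v, |t * r v| ≤ |t| * ρ := fun v => by
    rw [abs_mul]; gcongr; exact hρ v
  -- Uses `(1 + 2x)(1 - x) ≥ 1` for `0 ≤ x ≤ 1/2`, with `x = |t| ρ ≤ 1/4`.
  have hup : J t ≤ J 0 * (1 + 2 * (|t| * ρ)) := by
    refine (hJ t ht _ (by positivity)).2 fun v => (hB0 v).trans ?_
    have h1 := (abs_le.1 (htr v)).1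
    have h2 : 1 ≤ (1 + 2 * (|t| * ρ)) * (1 + t * r v) := by nlinarith
    rw [mul_assoc]
    nlinarith
  have hlow : J 0 ≤ J t * (1 + |t| * ρ) := by
    refine (hJ 0 h00 _ (by positivity)).2 fun v => ?_
    rw [zero_mul, add_zero, mul_one]
    refine (hBt v).trans ?_
    have h1 := (abs_le.1 (htr v)).2
    gcongr
  rw [abs_le]
  constructor <;> nlinarith

/-- Danskin's theorem for `J t = max_v B v / (1 + t r v)` with a unique maximiser at `t = 0`. -/
lemma hasDerivAt_envelope (hB : Continuous B) (hr : Continuous r) (hρ : ∀ v, |r v| ≤ ρ)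
    (hρ0 : 0 ≤ ρ) (hδ0 : 0 < δ) (hδ : δ * ρ ≤ 1 / 4) (hJpos : ∀ t, |t| < δ → 0 < J t)
    (hJ : ∀ t, |t| < δ → ∀ s, 0 < s → (J t ≤ s ↔ ∀ v, B v ≤ s * (1 + t * r v)))
    {v₀ : X} (hv₀ : B v₀ = J 0) (huniq : ∀ v, B v = J 0 → v = v₀) :
    HasDerivAt J (-(J 0 * r v₀)) 0 := by
  have h00 : |(0 : ℝ)| < δ := by rwa [abs_zero]
  have hJ0 := hJpos 0 h00
  have hB0 : ∀ v, B v ≤ J 0 := fun v => by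
    simpa using (hJ 0 h00 _ hJ0).1 le_rfl v
  rw [hasDerivAt_iff_isLittleO, Asymptotics.isLittleO_iff]
  intro ε hε
  -- a neighbourhood of the maximiser on which `r` is almost constant
  set U : Set X := {v | |r v - r v₀| < ε / (4 * J 0)} with hU
  have hUo : IsOpen U := isOpen_lt (by fun_prop) continuous_const
  have hv₀U : v₀ ∈ U := by
    simp only [hU, mem_ofPred_eq, sub_self, abs_zero]; positivity
  -- Uniqueness of the maximiser and compactness leave a uniform gap away from `v₀`.
  obtain ⟨η, hη0, hη⟩ : ∃ η, 0 < η ∧ ∀ v ∈ Uᶜ, η ≤ J 0 - B v := by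
    refine hUo.isClosed_compl.isCompact.exists_forall_le' (by fun_prop) fun v hv => ?_
    rw [sub_pos]
    exact lt_of_le_of_ne (hB0 v) fun h => hv (huniq v h ▸ hv₀U)
  have hC : 0 < J 0 * ρ ^ 2 + ε * ρ + 1 := by positivity
  have hD : 0 < 2 * J 0 * ρ + 1 := by positivity
  have hlim : Tendsto (fun t : ℝ => |t|) (𝓝 0) (𝓝 0) := by
    simpa using (continuous_abs.tendsto (0 : ℝ))
  filter_upwards [hlim.eventually_lt_const hδ0,
    hlim.eventually_lt_const (div_pos (half_pos hε) hC),
    hlim.eventually_lt_const (div_pos hη0 hD)] with t ht ht1 ht2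
  rw [lt_div_iff₀ hC] at ht1
  rw [lt_div_iff₀ hD] at ht2
  have hJt := hJpos t ht
  have habs := abs_nonneg t
  have htρ : |t| * ρ ≤ 1 / 4 := le_trans (by gcongr) hδ
  have htr : ∀ v, |t * r v| ≤ |t| * ρ := fun v => by
    rw [abs_mul]; gcongr; exact hρ v
  simp only [sub_zero, smul_eq_mul, Real.norm_eq_abs]
  have h0 := abs_le.1 (htr v₀)
  -- Testing the constraint at `v₀` alone gives `J t ≥ J 0 / (1 + t r v₀)`, and `(1 - x)(1 + x) ≤
  -- 1`.
  have hlow : J 0 * (1 - t * r v₀) ≤ J t := by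
    have h1 := (hJ t ht _ hJt).1 le_rfl v₀
    rw [hv₀] at h1
    have h2 : 0 < 1 + t * r v₀ := by linarith
    have h3 : 0 < 1 - t * r v₀ := by linarith
    refine le_of_mul_le_mul_right ?_ h2
    nlinarith [sq_nonneg (t * r v₀)]
  have hup : J t ≤ J 0 * (1 - t * r v₀) + ε * |t| := by
    have hs1 : J 0 * (1 - |t| * ρ) ≤ J 0 * (1 - t * r v₀) + ε * |t| := by
      have : J 0 * (1 - |t| * ρ) ≤ J 0 * (1 - t * r v₀) :=
        mul_le_mul_of_nonneg_left (by linarith) hJ0.le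
      nlinarith
    have hs0 : 0 < J 0 * (1 - |t| * ρ) := mul_pos hJ0 (by linarith)
    refine (hJ t ht _ (hs0.trans_le hs1)).2 fun v => ?_
    have hv := abs_le.1 (htr v)
    -- Near `v₀`, variation of `r` costs at most `ε|t|/4` and the quadratic terms at most `ε|t|/2`,
    -- within the allowance `ε|t|`. Away from `v₀`, the gap `η` dominates the change `2 J(0) ρ |t|`.
    by_cases hvU : v ∈ U
    · refine (hB0 v).trans ?_
      have h1 : |t * (r v - r v₀)| ≤ |t| * (ε / (4 * J 0)) := by
        rw [abs_mul]; gcongr; exact le_of_lt hvU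
      have h2 := (abs_le.1 h1).1
      have h3 : J 0 * (|t| * (ε / (4 * J 0))) = ε * |t| / 4 := by field_simp
      have h4 : -(ε * |t| / 4) ≤ J 0 * (t * (r v - r v₀)) := by
        rw [← h3, ← mul_neg]; gcongr
      have h5 : (t * r v₀) * (t * r v) ≤ (|t| * ρ) * (|t| * ρ) := by
        refine (le_abs_self _).trans ?_
        rw [abs_mul]
        exact mul_le_mul (htr v₀) (htr v) (abs_nonneg _) (by positivity)
      have h6 : J 0 * ((t * r v₀) * (t * r v)) ≤ J 0 * ((|t| * ρ) * (|t| * ρ)) := by gcongr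
      have h7 : -(ε * |t| * (|t| * ρ)) ≤ ε * |t| * (t * r v) := by
        rw [← mul_neg]
        exact mul_le_mul_of_nonneg_left hv.1 (by positivity)
      have h8 : |t| * (|t| * (J 0 * ρ ^ 2 + ε * ρ + 1)) ≤ |t| * (ε / 2) := by gcongr
      nlinarith [mul_nonneg hε.le habs]
    · have h1 := hη v hvU
      have h2 : J 0 - η ≤ J 0 * (1 - |t| * ρ) * (1 - |t| * ρ) := by
        nlinarith [mul_nonneg hJ0.le (sq_nonneg (|t| * ρ))]
      have h3 : J 0 * (1 - |t| * ρ) * (1 - |t| * ρ) ≤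
          (J 0 * (1 - t * r v₀) + ε * |t|) * (1 + t * r v) := by
        refine mul_le_mul hs1 (by linarith) (by linarith) (hs0.le.trans hs1)
      linarith
  rw [abs_le]
  constructor <;> nlinarith [mul_nonneg hε.le habs]

end Envelope

/-! ### The quermassintegral as an integral over directions. -/

section RadialIntegral

open scoped ENNReal

variable {n : ℕ}

/-- The radial Gaussian density `e^{-r²/2} r^{q-1}`. -/
noncomputable def radialKernel (q r : ℝ) : ℝ := Real.exp (-r ^ 2 / 2) * r ^ (q - 1)

/-- The mass of the radial Gaussian density on `[0, x]`. -/
noncomputable def radialMass (q x : ℝ) : ℝ := ∫ r in (0 : ℝ)..x, radialKernel q r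

/-- Here `q > 1` enters: it makes `r^(q-1)` continuous at `0`, so that `radialMass` is
differentiable everywhere. -/
lemma continuous_radialKernel {q : ℝ} (hq : 1 < q) : Continuous (radialKernel q) := by
  have h : Continuous fun r : ℝ => r ^ (q - 1) :=
    continuous_id.rpow_const fun _ => Or.inr (by linarith)
  unfold radialKernel
  fun_prop

lemma hasDerivAt_radialMass {q : ℝ} (hq : 1 < q) (x : ℝ) :
    HasDerivAt (radialMass q) (radialKernel q x) x :=
  ((continuous_radialKernel hq).integral_hasStrictDerivAt 0 x).hasDerivAt

lemma radialKernel_nonneg {q r : ℝ} (hr : 0 ≤ r) : 0 ≤ radialKernel q r := by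
  unfold radialKernel; positivity

/-- In polar coordinates the density becomes `r^(q-1) e^{-r²/2}`, integrable on the half-line. Every
finiteness claim about quermassintegrals follows. -/
lemma integrable_gaussKernel (hn : 1 ≤ n) {q : ℝ} (hq : 1 < q) :
    Integrable (gaussKernel q : E n → ℝ) := by
  have : Nonempty (Fin n) := ⟨⟨0, hn⟩⟩
  have h := (integrable_fun_norm_addHaar (volume : Measure (E n))
    (f := fun r : ℝ => Real.exp (-r ^ 2 / 2) * r ^ (q - n))).2 ?_
  · exact h
  rw [finrank_euclideanSpace_fin]
  have h1 := (integrable_rpow_mul_exp_neg_mul_sq (b := 1 / 2) (by norm_num)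
    (s := q - 1) (by linarith)).integrableOn (s := Ioi (0 : ℝ))
  refine h1.congr_fun (fun r hr => ?_) measurableSet_Ioi
  have hr' : (0 : ℝ) < r := hr
  simp only [smul_eq_mul]
  rw [← Real.rpow_natCast r (n - 1), mul_left_comm, ← Real.rpow_add hr', Nat.cast_sub hn, mul_comm]
  congr 2
  · ring
  · push_cast; ring

/-- The Gaussian dual quermassintegral in polar coordinates. -/
lemma gaussDualQuermass_eq (hn : 1 ≤ n) {q : ℝ} (hq : 1 < q) {L : Set (E n)} (hL : IsCompact L)
    (hc : Convex ℝ L) (h0 : (0 : E n) ∈ interior L) :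
    gaussDualQuermass q L =
      ∫ u : S n, radialMass q (gauge L (u : E n))⁻¹ ∂(volume : Measure (E n)).toSphere := by
  have hk : Measurable fun x : E n => gaussKernel q x := by
    unfold gaussKernel; fun_prop
  have hk0 : ∀ x : E n, 0 ≤ gaussKernel q x := fun x => by unfold gaussKernel; positivity
  have hκ := continuous_radialKernel hq
  -- The ray in direction `u` leaves `L` at `1 / gauge L u`, and `r^(n-1) r^(q-n) = r^(q-1)`.
  have hinner : ∀ u : S n, ∫⁻ r : Ioi (0 : ℝ),
      L.indicator (fun x => ENNReal.ofReal (gaussKernel q x)) (r.1 • (u : E n))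
        ∂(Measure.volumeIoiPow (n - 1)) = ENNReal.ofReal (radialMass q (gauge L (u : E n))⁻¹) := by
    intro u
    have hg := gauge_sphere_pos hL h0 u
    have hmeas : Measurable fun r : ℝ =>
        L.indicator (fun x => ENNReal.ofReal (gaussKernel q x)) (r • (u : E n)) :=
      (Measurable.indicator (by fun_prop) hL.measurableSet).comp (by fun_prop)
    rw [Measure.volumeIoiPow, lintegral_withDensity_eq_lintegral_mul
      (g := fun r : Ioi (0 : ℝ) => L.indicator (fun x => ENNReal.ofReal (gaussKernel q x))
        (r.1 • (u : E n))) _ (by fun_prop) (hmeas.comp measurable_subtype_coe)]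
    simp only [Pi.mul_apply]
    rw [lintegral_subtype_comap measurableSet_Ioi (fun r : ℝ => ENNReal.ofReal (r ^ (n - 1)) *
      L.indicator (fun x => ENNReal.ofReal (gaussKernel q x)) (r • (u : E n)))]
    have h1 : ∀ r ∈ Ioi (0 : ℝ), ENNReal.ofReal (r ^ (n - 1)) *
        L.indicator (fun x => ENNReal.ofReal (gaussKernel q x)) (r • (u : E n)) =
        (Iic (gauge L (u : E n))⁻¹).indicator (fun r => ENNReal.ofReal (radialKernel q r)) r := by
      intro r hr
      have hr' : (0 : ℝ) < r := hr
      have hiff : r • (u : E n) ∈ L ↔ r ∈ Iic (gauge L (u : E n))⁻¹ := by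
        have h := gauge_le_one_iff_mem_closure (x := r • (u : E n)) hc
          (mem_interior_iff_mem_nhds.1 h0)
        rw [hL.isClosed.closure_eq] at h
        rw [← h, gauge_smul_of_nonneg hr'.le, smul_eq_mul, mem_Iic, ← one_div, le_div_iff₀ hg]
      by_cases hm : r • (u : E n) ∈ L
      · rw [indicator_of_mem hm, indicator_of_mem (hiff.1 hm),
          ← ENNReal.ofReal_mul (by positivity), gaussKernel, radialKernel, norm_smul, norm_sphere,
          mul_one, Real.norm_of_nonneg hr'.le, mul_left_comm, ← Real.rpow_natCast r (n - 1),
          ← Real.rpow_add hr', Nat.cast_sub hn]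
        congr 3
        push_cast; ring
      · rw [indicator_of_notMem hm, indicator_of_notMem fun h => hm (hiff.2 h), mul_zero]
    rw [setLIntegral_congr_fun measurableSet_Ioi h1, lintegral_indicator measurableSet_Iic,
      Measure.restrict_restrict measurableSet_Iic, Iic_inter_Ioi, radialMass,
      intervalIntegral.integral_of_le (inv_nonneg.2 hg.le), ofReal_integral_eq_lintegral_ofReal]
    · exact (hκ.intervalIntegrable _ _).1
    · filter_upwards [ae_restrict_mem measurableSet_Ioc] with r hr using radialKernel_nonneg hr.1.le
  have hρ : Continuous fun u : S n => (gauge L (u : E n))⁻¹ :=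
    (continuous_gauge_sphere hc h0).inv₀ fun u => (gauge_sphere_pos hL h0 u).ne'
  have hmass : Continuous (radialMass q) :=
    continuous_iff_continuousAt.2 fun x => (hasDerivAt_radialMass hq x).continuousAt
  have hmρ : Continuous fun u : S n => radialMass q (gauge L (u : E n))⁻¹ := hmass.comp hρ
  rw [gaussDualQuermass, integral_eq_lintegral_of_nonneg_ae (Eventually.of_forall hk0)
    hk.aestronglyMeasurable, integral_eq_lintegral_of_nonneg_ae ?_
    hmρ.aestronglyMeasurable, ← lintegral_indicator hL.measurableSet,
    lintegral_polar hn (Measurable.indicator (by fun_prop) hL.measurableSet)]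
  · simp_rw [hinner]
  · refine Eventually.of_forall fun u => ?_
    have := inv_nonneg.2 (gauge_sphere_pos hL h0 u).le
    exact intervalIntegral.integral_nonneg this fun r hr => radialKernel_nonneg hr.1

end RadialIntegral

/-! ### Differentiation along the perturbed Wulff shapes. -/

section Variation

open scoped ENNReal

variable {n : ℕ}

/-- Truncation at `0` is needed because real powers are not monotone on negative numbers;
constraints with `⟨u,v⟩ < 0` hold automatically. -/
lemma le_rpow_one_div_iff {p x y : ℝ} (hp : 0 < p) (hy : 0 ≤ y) :
    x ≤ y ^ (1 / p) ↔ max x 0 ^ p ≤ y := by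
  rw [one_div, ← Real.le_rpow_inv_iff_of_pos (le_max_right x 0) hy hp, max_le_iff]
  simp [Real.rpow_nonneg hy]

/-- Data for the perturbation `h_t` on an interval of parameters: uniform positive bounds on
`h_K ^ p` and a small bound on the relative perturbation. -/
lemma exists_perturbation_bounds (hn : 1 ≤ n) {a g : S n → ℝ} (ha : Continuous a)
    (hg : Continuous g) (hpos : ∀ v, 0 < a v) :
    ∃ α β ρ δ : ℝ, 0 < α ∧ 0 ≤ ρ ∧ 0 < δ ∧ δ * ρ ≤ 1 / 4 ∧ (∀ v, |g v / a v| ≤ ρ) ∧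
      ∀ t, |t| < δ → ∀ v, α / 2 ≤ a v + t * g v ∧ a v + t * g v ≤ 2 * β := by
  have := nonempty_sphere hn
  obtain ⟨v₁, -, hv₁⟩ := isCompact_univ.exists_isMinOn univ_nonempty ha.continuousOn
  obtain ⟨v₂, -, hv₂⟩ := isCompact_univ.exists_isMaxOn univ_nonempty ha.continuousOn
  have hq : Continuous fun v => |g v / a v| := (hg.div ha fun v => (hpos v).ne').abs
  obtain ⟨v₃, -, hv₃⟩ := isCompact_univ.exists_isMaxOn univ_nonempty hq.continuousOn
  have h1 : ∀ v, a v₁ ≤ a v := fun v => hv₁ (mem_univ v)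
  have h2 : ∀ v, a v ≤ a v₂ := fun v => hv₂ (mem_univ v)
  have h3 : ∀ v, |g v / a v| ≤ |g v₃ / a v₃| := fun v => hv₃ (mem_univ v)
  set ρ := |g v₃ / a v₃|
  have hρ0 : 0 ≤ ρ := abs_nonneg _
  have hδρ : 1 / (4 * (ρ + 1)) * ρ ≤ 1 / 4 := by
    rw [div_mul_eq_mul_div, div_le_div_iff₀ (by positivity) (by norm_num)]
    linarith
  -- The `+ 1` keeps `δ` finite when `ρ = 0`. As `δ ρ ≤ 1/4`, the factor `1 + t g/a` stays between
  -- `3/4` and `5/4`.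
  refine ⟨a v₁, a v₂, ρ, 1 / (4 * (ρ + 1)), hpos v₁, hρ0, by positivity, hδρ, h3, ?_⟩
  intro t ht v
  have h4 : a v + t * g v = a v * (1 + t * (g v / a v)) := by
    field_simp [(hpos v).ne']
  have h5 : |t * (g v / a v)| ≤ 1 / 4 := by
    rw [abs_mul]
    exact (mul_le_mul ht.le (h3 v) (abs_nonneg _) (by positivity)).trans hδρ
  have h6 := abs_le.1 h5
  rw [h4]
  constructor <;> nlinarith [hpos v, h1 v, h2 v]

/-- Chain rule along the radial function `J ^ (-1/p)`. -/
lemma hasDerivAt_radialMass_rpow {p q : ℝ} (hq : 1 < q) {x : ℝ} (hx : 0 < x) :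
    HasDerivAt (fun x : ℝ => radialMass q (x ^ (-(1 / p))))
      (radialKernel q (x ^ (-(1 / p))) * (-(1 / p) * x ^ (-(1 / p) - 1))) x :=
  (hasDerivAt_radialMass hq _).comp x (Real.hasDerivAt_rpow_const (Or.inl hx.ne'))

/-- The derivative is continuous, hence bounded on a compact interval away from `0`; the mean value
inequality applies. -/
lemma exists_lipschitz_radialMass_rpow (p : ℝ) {q : ℝ} (hq : 1 < q) {c d : ℝ} (hc : 0 < c) :
    ∃ C, 0 ≤ C ∧ ∀ x ∈ Icc c d, ∀ y ∈ Icc c d,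
      |radialMass q (y ^ (-(1 / p))) - radialMass q (x ^ (-(1 / p)))| ≤ C * |y - x| := by
  have hcont : ContinuousOn (fun x : ℝ =>
      radialKernel q (x ^ (-(1 / p))) * (-(1 / p) * x ^ (-(1 / p) - 1))) (Icc c d) := by
    have h : ∀ s : ℝ, ContinuousOn (fun x : ℝ => x ^ s) (Icc c d) := fun s =>
      continuousOn_id.rpow_const fun x hx => Or.inl (hc.trans_le hx.1).ne'
    exact ((continuous_radialKernel hq).comp_continuousOn (h _)).mul (continuousOn_const.mul (h _))
  obtain ⟨C, hC⟩ := isCompact_Icc.exists_bound_of_continuousOn hcont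
  refine ⟨max C 0, le_max_right _ _, fun x hx y hy => ?_⟩
  have h := (convex_Icc c d).norm_image_sub_le_of_norm_hasDerivWithin_le (C := max C 0)
    (fun z hz => (hasDerivAt_radialMass_rpow (p := p) hq (hc.trans_le hz.1)).hasDerivWithinAt)
    (fun z hz => (hC z hz).trans (le_max_left _ _)) hx hy
  simpa only [Real.norm_eq_abs] using h

lemma wulffShape_lpPerturbation_zero {p : ℝ} (hp : 0 < p) {K : Set (E n)} (hK : IsCompact K)
    (hc : Convex ℝ K) (h0 : (0 : E n) ∈ interior K) (f : S n → ℝ) :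
    wulffShape (lpPerturbation p K f 0) = K := by
  have h : lpPerturbation p K f 0 = fun v : S n => supportFun K v := by
    ext v
    rw [lpPerturbation, zero_mul, add_zero, one_div,
      Real.rpow_rpow_inv (supportFun_pos hK h0 v).le hp.ne']
  rw [h, wulffShape_supportFun hK hc ⟨0, interior_subset h0⟩]

lemma wulffShape_lpPerturbation_spec (hn : 1 ≤ n) {p : ℝ} (hp : 0 < p) {K : Set (E n)}
    {f : S n → ℝ} {t c d : ℝ} (hc : 0 < c)
    (h : ∀ v : S n, c ≤ supportFun K v ^ p + t * f v ^ p ∧ supportFun K v ^ p + t * f v ^ p ≤ d) :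
    IsCompact (wulffShape (lpPerturbation p K f t)) ∧
      (0 : E n) ∈ interior (wulffShape (lpPerturbation p K f t)) := by
  obtain ⟨v⟩ := nonempty_sphere hn
  have hd : 0 ≤ d := hc.le.trans ((h v).1.trans (h v).2)
  have hp' : 0 ≤ 1 / p := by positivity
  refine ⟨isCompact_wulffShape (Real.rpow_nonneg hd (1 / p)) fun v => ?_,
    zero_mem_interior_wulffShape (Real.rpow_pos_of_pos hc (1 / p)) fun v => ?_⟩
  · exact Real.rpow_le_rpow (hc.le.trans (h v).1) (h v).2 hp'
  · exact Real.rpow_le_rpow hc.le (h v).1 hp'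

/-- The `p`-th power of the gauge of a perturbed Wulff shape as a maximum. -/
lemma gauge_rpow_le_iff {p : ℝ} (hp : 0 < p) {K : Set (E n)} {f : S n → ℝ} {t : ℝ}
    (hpos : ∀ v : S n, 0 < supportFun K v) (ht : ∀ v : S n, 0 < supportFun K v ^ p + t * f v ^ p)
    (h0 : (0 : E n) ∈ interior (wulffShape (lpPerturbation p K f t))) (u : E n) {s : ℝ}
    (hs : 0 < s) :
    gauge (wulffShape (lpPerturbation p K f t)) u ^ p ≤ s ↔
      ∀ v : S n, max (inner ℝ u (v : E n)) 0 ^ p / supportFun K v ^ p ≤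
        s * (1 + t * (f v ^ p / supportFun K v ^ p)) := by
  have hsp : 0 < s ^ p⁻¹ := Real.rpow_pos_of_pos hs _
  rw [← Real.le_rpow_inv_iff_of_pos (gauge_nonneg u) hs.le hp, gauge_wulffShape_le_iff h0 hsp]
  refine forall_congr' fun v => ?_
  have ha : 0 < supportFun K v ^ p := Real.rpow_pos_of_pos (hpos v) p
  have h1 : s * (1 + t * (f v ^ p / supportFun K v ^ p)) =
      s * (supportFun K v ^ p + t * f v ^ p) / supportFun K v ^ p := by
    field_simp
  rw [h1, div_le_div_iff_of_pos_right ha, ← le_rpow_one_div_iff hp (mul_pos hs (ht v)).le,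
    Real.mul_rpow hs.le (ht v).le, lpPerturbation, one_div]

/-- Differentiation of the Gaussian dual quermassintegral along `h_t`, in radial coordinates. -/
lemma hasDerivAt_gaussDualQuermass (hn : 1 ≤ n) {p q : ℝ} (hp : 1 < p) (hq : 1 < q)
    {K : Set (E n)} (hK : IsCompact K) (hc : Convex ℝ K) (h0 : (0 : E n) ∈ interior K)
    {f : S n → ℝ} (hf : Continuous f) (v₀ : S n) :
    Integrable (fun u : S n => 1 / p * (Real.exp (-(gauge K (u : E n))⁻¹ ^ 2 / 2) *
        (gauge K (u : E n))⁻¹ ^ q * supportFun K (gaussMapExt K v₀ (radialMap K u) : E n) ^ (-p) *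
          f (gaussMapExt K v₀ (radialMap K u)) ^ p)) (volume : Measure (E n)).toSphere ∧
      HasDerivAt (fun t => gaussDualQuermass q (wulffShape (lpPerturbation p K f t)))
        (∫ u : S n, 1 / p * (Real.exp (-(gauge K (u : E n))⁻¹ ^ 2 / 2) *
          (gauge K (u : E n))⁻¹ ^ q *
          supportFun K (gaussMapExt K v₀ (radialMap K u) : E n) ^ (-p) *
          f (gaussMapExt K v₀ (radialMap K u)) ^ p) ∂(volume : Measure (E n)).toSphere) 0 := by
  have hp0 : 0 < p := by linarith
  have hpos := fun v : S n => supportFun_pos hK h0 v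
  have hh : Continuous fun v : S n => supportFun K (v : E n) :=
    (continuous_supportFun hK ⟨0, interior_subset h0⟩).comp continuous_subtype_val
  have ha : Continuous fun v : S n => supportFun K (v : E n) ^ p :=
    hh.rpow_const fun v => Or.inr hp0.le
  have hg : Continuous fun v : S n => f v ^ p := hf.rpow_const fun v => Or.inr hp0.le
  have hapos : ∀ v : S n, 0 < supportFun K (v : E n) ^ p := fun v => Real.rpow_pos_of_pos (hpos v) p
  obtain ⟨α, β, ρ, δ, hα, hρ0, hδ, hδρ, hρ, hbd⟩ := exists_perturbation_bounds hn ha hg hapos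
  have hpt : ∀ t, |t| < δ → ∀ v : S n, 0 < supportFun K v ^ p + t * f v ^ p := fun t ht v =>
    (half_pos hα).trans_le (hbd t ht v).1
  have hspec := fun t ht => wulffShape_lpPerturbation_spec hn hp0 (half_pos hα) (hbd t ht)
  have hzero := wulffShape_lpPerturbation_zero hp0 hK hc h0 f
  set L : ℝ → Set (E n) := fun t => wulffShape (lpPerturbation p K f t) with hL
  have hL0 : L 0 = K := hzero
  have hLc : ∀ t, Convex ℝ (L t) := fun t => convex_wulffShape _
  -- The `p`-th power makes the denominators in the maximum affine in `t`.
  set J : S n → ℝ → ℝ := fun u t => gauge (L t) (u : E n) ^ p with hJdef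
  have hJpos : ∀ u t, |t| < δ → 0 < J u t := fun u t ht =>
    Real.rpow_pos_of_pos (gauge_sphere_pos (hspec t ht).1 (hspec t ht).2 u) p
  have hJiff : ∀ u t, |t| < δ → ∀ s, 0 < s → (J u t ≤ s ↔
      ∀ v : S n, max (inner ℝ (u : E n) (v : E n)) 0 ^ p / supportFun K v ^ p ≤
        s * (1 + t * (f v ^ p / supportFun K v ^ p))) := fun u t ht s hs =>
    gauge_rpow_le_iff hp0 hpos (hpt t ht) (hspec t ht).2 u hs
  have hJρ : ∀ (u : S n) (t : ℝ), radialMass q (gauge (L t) (u : E n))⁻¹ =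
      radialMass q (J u t ^ (-(1 / p))) := by
    intro u t
    rw [hJdef, one_div, Real.rpow_neg (Real.rpow_nonneg (gauge_nonneg _) _),
      Real.rpow_rpow_inv (gauge_nonneg _) hp0.ne']
  have hJ0c : Continuous fun u => J u 0 := by
    simp only [hJdef, hL0]
    exact (continuous_gauge_sphere hc h0).rpow_const fun v => Or.inr hp0.le
  have h00 : |(0 : ℝ)| < δ := by rwa [abs_zero]
  have := nonempty_sphere hn
  obtain ⟨u₁, -, hu₁⟩ := isCompact_univ.exists_isMinOn univ_nonempty hJ0c.continuousOn
  obtain ⟨u₂, -, hu₂⟩ := isCompact_univ.exists_isMaxOn univ_nonempty hJ0c.continuousOn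
  have hJ1 : ∀ u, J u₁ 0 ≤ J u 0 := fun u => hu₁ (mem_univ u)
  have hJ2 : ∀ u, J u 0 ≤ J u₂ 0 := fun u => hu₂ (mem_univ u)
  have hj1 : 0 < J u₁ 0 := hJpos u₁ 0 h00
  -- For `|t| < δ` the envelope moves by at most half of `J u 0`, so all values of `J` lie in this
  -- interval and `C` is independent of `u`.
  obtain ⟨C, hC0, hC⟩ := exists_lipschitz_radialMass_rpow p hq (c := J u₁ 0 / 2)
    (d := 2 * J u₂ 0) (half_pos hj1)
  have hlip : ∀ (u : S n) (t : ℝ), |t| < δ → |radialMass q (gauge (L t) (u : E n))⁻¹ -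
      radialMass q (gauge (L 0) (u : E n))⁻¹| ≤ C * (2 * J u₂ 0 * ρ) * |t| := by
    intro u t ht
    have h1 := abs_envelope_sub_le hρ hρ0 hδρ (hJpos u) (hJiff u) ht
    have h2 : |t| * ρ ≤ 1 / 4 := le_trans (by gcongr) hδρ
    have h3 : 0 < J u 0 := hJpos u 0 h00
    have h4 : |J u t - J u 0| ≤ J u 0 / 2 := by nlinarith
    have h5 := abs_le.1 h4
    have h6 := hJ1 u
    have h7 := hJ2 u
    rw [hJρ, hJρ]
    refine (hC _ ⟨by linarith, by linarith⟩ _ ⟨by linarith, by linarith⟩).trans ?_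
    rw [mul_assoc]
    gcongr
    refine h1.trans ?_
    gcongr
  have hT := (continuous_radialMap hK hc h0).measurable
  have hN := (measurable_gaussMapExt hK v₀).comp hT
  set D : S n → ℝ := fun u => 1 / p * (Real.exp (-(gauge K (u : E n))⁻¹ ^ 2 / 2) *
    (gauge K (u : E n))⁻¹ ^ q * supportFun K (gaussMapExt K v₀ (radialMap K u) : E n) ^ (-p) *
      f (gaussMapExt K v₀ (radialMap K u)) ^ p) with hD
  have hDm : Measurable D := by
    have h1 : Measurable fun u : S n => supportFun K (gaussMapExt K v₀ (radialMap K u) : E n) :=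
      hh.measurable.comp hN
    have h2 : Measurable fun u : S n => f (gaussMapExt K v₀ (radialMap K u)) :=
      hf.measurable.comp hN
    have h3 := (continuous_gauge_sphere hc h0).measurable
    have h4 : Measurable fun u : S n => (gauge K (u : E n))⁻¹ ^ q := h3.inv.pow_const q
    have h5 : Measurable fun u : S n =>
      supportFun K (gaussMapExt K v₀ (radialMap K u) : E n) ^ (-p) := h1.pow_const _
    have h6 : Measurable fun u : S n => f (gaussMapExt K v₀ (radialMap K u)) ^ p := h2.pow_const _
    fun_prop
  have hderiv : ∀ᵐ u : S n ∂(volume : Measure (E n)).toSphere,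
      HasDerivAt (fun t => radialMass q (gauge (L t) (u : E n))⁻¹) (D u) 0 := by
    filter_upwards [ae_radialMap_mem_regularBoundary hn hK hc h0] with u hu
    have hgu := gauge_sphere_pos hK h0 u
    have hJu : J u 0 = gauge K (u : E n) ^ p := by rw [hJdef]; simp only [hL0]
    set v₁ := gaussMapExt K v₀ (radialMap K u) with hv₁
    have hin : inner ℝ (u : E n) (v₁ : E n) = gauge K (u : E n) * supportFun K v₁ :=
      (isOuterNormal_inv_smul_iff hK h0 (sphere_ne_zero u)).1 (isOuterNormal_gaussMapExt v₀ hu)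
    have hval : max (inner ℝ (u : E n) (v₁ : E n)) 0 ^ p / supportFun K v₁ ^ p = J u 0 := by
      rw [hin, max_eq_left (mul_pos hgu (hpos v₁)).le, Real.mul_rpow hgu.le (hpos v₁).le,
        mul_div_cancel_right₀ _ (hapos v₁).ne', hJu]
    -- A maximiser has `⟨u,v⟩₊ = gauge K u · h_K(v) > 0`, so the truncation is inactive and `v` is
    -- an outer normal at a regular point.
    have huniq : ∀ v : S n, max (inner ℝ (u : E n) (v : E n)) 0 ^ p / supportFun K v ^ p = J u 0 →
        v = v₁ := by
      intro v hv
      refine eq_gaussMapExt v₀ hu ((isOuterNormal_inv_smul_iff hK h0 (sphere_ne_zero u)).2 ?_)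
      rw [div_eq_iff (hapos v).ne', hJu, ← Real.mul_rpow hgu.le (hpos v).le,
        Real.rpow_left_inj (le_max_right _ _) (mul_pos hgu (hpos v)).le hp0.ne'] at hv
      rcases max_choice (inner ℝ (u : E n) (v : E n)) 0 with h | h
      · rwa [h] at hv
      · rw [h] at hv
        exact absurd hv (mul_pos hgu (hpos v)).ne
    have hBc : Continuous fun v : S n =>
        max (inner ℝ (u : E n) (v : E n)) 0 ^ p / supportFun K v ^ p := by
      refine Continuous.div ?_ ha fun v => (hapos v).ne'
      have : Continuous fun v : S n => max (inner ℝ (u : E n) (v : E n)) 0 := by fun_prop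
      exact this.rpow_const fun v => Or.inr hp0.le
    have hrc : Continuous fun v : S n => f v ^ p / supportFun K v ^ p :=
      hg.div ha fun v => (hapos v).ne'
    have hJd := hasDerivAt_envelope hBc hrc hρ hρ0 hδ hδρ (hJpos u) (hJiff u) hval huniq
    have hcomp := (hasDerivAt_radialMass_rpow (p := p) hq (hJpos u 0 h00)).comp (0 : ℝ) hJd
    have hfun : (fun t => radialMass q (gauge (L t) (u : E n))⁻¹) =
        (fun x : ℝ => radialMass q (x ^ (-(1 / p)))) ∘ J u := by
      ext t; exact hJρ u t
    rw [hfun]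
    refine hcomp.congr_deriv ?_
    have hJinv : J u 0 ^ (-(1 / p)) = (gauge K (u : E n))⁻¹ := by
      rw [hJu, one_div, Real.rpow_neg (Real.rpow_nonneg hgu.le _),
        Real.rpow_rpow_inv hgu.le hp0.ne']
    have hJs : J u 0 ^ (-(1 / p) - 1) * J u 0 = (gauge K (u : E n))⁻¹ := by
      rw [← hJinv, Real.rpow_sub_one (hJpos u 0 h00).ne', div_mul_cancel₀ _ (hJpos u 0 h00).ne']
    have hρp := inv_pos.2 hgu
    have hqs : (gauge K (u : E n))⁻¹ ^ (q - 1) * (gauge K (u : E n))⁻¹ =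
        (gauge K (u : E n))⁻¹ ^ q := by
      rw [Real.rpow_sub_one hρp.ne', div_mul_cancel₀ _ hρp.ne']
    simp only [hD, ← hv₁]
    rw [hJinv, Real.rpow_neg (hpos v₁).le, ← hqs, radialKernel]
    calc _ = Real.exp (-(gauge K (u : E n))⁻¹ ^ 2 / 2) * (gauge K (u : E n))⁻¹ ^ (q - 1) *
          (1 / p) * (J u 0 ^ (-(1 / p) - 1) * J u 0) * (f v₁ ^ p / supportFun K v₁ ^ p) := by ring
      _ = _ := by rw [hJs]; ring
  have hmassc : Continuous (radialMass q) :=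
    continuous_iff_continuousAt.2 fun x => (hasDerivAt_radialMass hq x).continuousAt
  have hFc : ∀ t, |t| < δ → Continuous fun u : S n => radialMass q (gauge (L t) (u : E n))⁻¹ :=
    fun t ht => hmassc.comp ((continuous_gauge_sphere (hLc t) (hspec t ht).2).inv₀
      fun u => (gauge_sphere_pos (hspec t ht).1 (hspec t ht).2 u).ne')
  have hball : ∀ t ∈ Metric.ball (0 : ℝ) δ, |t| < δ := fun t ht => by simpa using ht
  -- This form needs only a Lipschitz bound against the base point `t = 0` and differentiability
  -- there for almost every `u`; the bound is constant and the sphere has finite measure.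
  obtain ⟨hint, hfd⟩ := hasFDerivAt_integral_of_dominated_loc_of_lip'
    (μ := (volume : Measure (E n)).toSphere) (𝕜 := ℝ) (x₀ := (0 : ℝ))
    (F := fun t (u : S n) => radialMass q (gauge (L t) (u : E n))⁻¹)
    (F' := fun u => ContinuousLinearMap.toSpanSingleton ℝ (D u))
    (bound := fun _ => C * (2 * J u₂ 0 * ρ))
    (Metric.ball_mem_nhds (0 : ℝ) hδ) (fun t ht => (hFc t (hball t ht)).aestronglyMeasurable)
    ((hFc 0 h00).integrable_of_hasCompactSupport (HasCompactSupport.of_compactSpace _))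
    (ContinuousLinearMap.toSpanSingletonCLE.continuous.comp_aestronglyMeasurable
      hDm.aestronglyMeasurable)
    (Eventually.of_forall fun u t ht => by
      simpa only [Real.norm_eq_abs, sub_zero] using hlip u t (hball t ht))
    (integrable_const _)
    (hderiv.mono fun u hu => hu.hasFDerivAt)
  have hDint : Integrable D (volume : Measure (E n)).toSphere := by
    simpa using hint.apply_continuousLinearMap (1 : ℝ)
  refine ⟨hDint, ?_⟩
  have hd := hfd.hasDerivAt
  rw [ContinuousLinearMap.integral_apply hint] at hd
  simp only [ContinuousLinearMap.toSpanSingleton_apply, one_smul] at hd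
  refine hd.congr_of_eventuallyEq ?_
  filter_upwards [Metric.ball_mem_nhds (0 : ℝ) hδ] with t ht
  exact gaussDualQuermass_eq hn hq (hspec t (hball t ht)).1 (hLc t) (hspec t (hball t ht)).2

end Variation

/-! ### Transfer to the curvature measure and the theorem. -/

section Main

variable {n : ℕ}

/-- Integration against the `L_p` Gaussian dual curvature measure in radial coordinates. -/
lemma integrable_and_integral_lpGaussDualCurvature (hn : 1 ≤ n) {p q : ℝ} {K : Set (E n)} (hK : IsCompact K)
    (hc : Convex ℝ K) (h0 : (0 : E n) ∈ interior K) {φ : S n → ℝ} (hφ : Continuous φ) (v₀ : S n)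
    (hint : Integrable (fun u : S n => 1 / p * (Real.exp (-(gauge K (u : E n))⁻¹ ^ 2 / 2) *
        (gauge K (u : E n))⁻¹ ^ q * supportFun K (gaussMapExt K v₀ (radialMap K u) : E n) ^ (-p) *
          φ (gaussMapExt K v₀ (radialMap K u)))) (volume : Measure (E n)).toSphere) (hp : 0 < p) :
    Integrable φ (lpGaussDualCurvature p q K) ∧
      ∫ u : S n, 1 / p * (Real.exp (-(gauge K (u : E n))⁻¹ ^ 2 / 2) *
          (gauge K (u : E n))⁻¹ ^ q *
          supportFun K (gaussMapExt K v₀ (radialMap K u) : E n) ^ (-p) *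
          φ (gaussMapExt K v₀ (radialMap K u))) ∂(volume : Measure (E n)).toSphere =
        1 / p * ∫ v, φ v ∂(lpGaussDualCurvature p q K) := by
  have hT := (continuous_radialMap hK hc h0).measurable
  have hN : Measurable fun u => gaussMapExt K v₀ (radialMap K u) :=
    (measurable_gaussMapExt hK v₀).comp hT
  have hpos := fun v : S n => supportFun_pos hK h0 v
  have hh : Continuous fun v : S n => supportFun K (v : E n) :=
    (continuous_supportFun hK ⟨0, interior_subset h0⟩).comp continuous_subtype_val
  set d : S n → ℝ := fun u => Real.exp (-(gauge K (u : E n))⁻¹ ^ 2 / 2) *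
    (gauge K (u : E n))⁻¹ ^ q * supportFun K (gaussMapExt K v₀ (radialMap K u) : E n) ^ (-p) with hd
  have hd0 : ∀ u, 0 ≤ d u := fun u => by
    have h1 := inv_pos.2 (gauge_sphere_pos hK h0 u)
    have h2 := hpos (gaussMapExt K v₀ (radialMap K u))
    simp only [hd]
    positivity
  have hdm : Measurable d := by
    have h1 : Measurable fun u : S n => supportFun K (gaussMapExt K v₀ (radialMap K u) : E n) :=
      hh.measurable.comp hN
    have h3 := (continuous_gauge_sphere hc h0).measurable
    have h4 : Measurable fun u : S n => (gauge K (u : E n))⁻¹ ^ q := h3.inv.pow_const q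
    have h5 : Measurable fun u : S n =>
      supportFun K (gaussMapExt K v₀ (radialMap K u) : E n) ^ (-p) := h1.pow_const _
    fun_prop
  have hint' : Integrable (fun u : S n => d u * φ (gaussMapExt K v₀ (radialMap K u)))
      (volume : Measure (E n)).toSphere := by
    have := hint.const_mul p
    refine this.congr (Eventually.of_forall fun u => ?_)
    simp only [hd]
    field_simp
  have htop : ∀ᵐ u ∂(volume : Measure (E n)).toSphere, ENNReal.ofReal (d u) < ⊤ :=
    Eventually.of_forall fun u => ENNReal.ofReal_lt_top
  have hdom : Measurable fun u => ENNReal.ofReal (d u) := hdm.ennreal_ofReal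
  rw [lpGaussDualCurvature_eq_map hn p q hK hc h0 v₀]
  constructor
  · rw [integrable_map_measure hφ.aestronglyMeasurable hN.aemeasurable,
      integrable_withDensity_iff_integrable_smul' hdom htop]
    refine hint'.congr (Eventually.of_forall fun u => ?_)
    simp only [ENNReal.toReal_ofReal (hd0 u), smul_eq_mul, Function.comp_apply]
  · rw [integral_map hN.aemeasurable hφ.aestronglyMeasurable,
      integral_withDensity_eq_integral_toReal_smul hdom htop, integral_const_mul]
    congr 1
    refine integral_congr_ae (Eventually.of_forall fun u => ?_)
    change d u * _ = (ENNReal.ofReal (d u)).toReal • _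
    rw [ENNReal.toReal_ofReal (hd0 u), smul_eq_mul]

end Main

end GaussDual

theorem theorem3p1 (n : ℕ) (hn : 1 ≤ n) (p q : ℝ) (hp : 1 < p) (hq : 1 < q)
    (K : ConvexBody (GaussDual.E n)) (hK : (0 : GaussDual.E n) ∈ interior (K : Set (GaussDual.E n)))
    (f : GaussDual.S n → ℝ) (hf : Continuous f) :
    -- for small `|t|` the function `h_t` is well defined and positive, and its Wulff shape is a
    -- convex body with the origin in its interior and with finite quermassintegral
    (∃ δ : ℝ, 0 < δ ∧ ∀ t ∈ Set.Ioo (-δ) δ,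
      (∀ v : GaussDual.S n, 0 < GaussDual.supportFun (K : Set (GaussDual.E n)) v ^ p + t * f v ^ p) ∧
      (∃ L : ConvexBody (GaussDual.E n),
        (L : Set (GaussDual.E n)) =
          GaussDual.wulffShape (GaussDual.lpPerturbation p (K : Set (GaussDual.E n)) f t) ∧
        (0 : GaussDual.E n) ∈ interior (L : Set (GaussDual.E n)) ∧
        MeasureTheory.IntegrableOn (GaussDual.gaussKernel q) (L : Set (GaussDual.E n)))) ∧
    MeasureTheory.IntegrableOn (GaussDual.gaussKernel q) (K : Set (GaussDual.E n)) ∧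
    MeasureTheory.Integrable (fun v => f v ^ p)
      (GaussDual.lpGaussDualCurvature p q (K : Set (GaussDual.E n))) ∧
    -- the variational formula
    Filter.Tendsto
      (fun t : ℝ =>
        (GaussDual.gaussDualQuermass q
            (GaussDual.wulffShape (GaussDual.lpPerturbation p (K : Set (GaussDual.E n)) f t)) -
          GaussDual.gaussDualQuermass q (K : Set (GaussDual.E n))) / t)
      (nhdsWithin 0 {0}ᶜ)
      (nhds (1 / p * ∫ v, f v ^ p
        ∂(GaussDual.lpGaussDualCurvature p q (K : Set (GaussDual.E n))))) := by
  have hp0 : 0 < p := by linarith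
  have hKc := K.isCompact
  have hKconv := K.convex
  have hpos := fun v : GaussDual.S n => GaussDual.supportFun_pos hKc hK v
  have hh : Continuous fun v : GaussDual.S n => GaussDual.supportFun K (v : GaussDual.E n) :=
    (GaussDual.continuous_supportFun hKc K.nonempty).comp continuous_subtype_val
  have ha : Continuous fun v : GaussDual.S n => GaussDual.supportFun K (v : GaussDual.E n) ^ p :=
    hh.rpow_const fun v => Or.inr hp0.le
  have hg : Continuous fun v : GaussDual.S n => f v ^ p := hf.rpow_const fun v => Or.inr hp0.le
  have hint := GaussDual.integrable_gaussKernel hn hq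
  obtain ⟨v₀⟩ := GaussDual.nonempty_sphere hn
  obtain ⟨hI, hD⟩ := GaussDual.hasDerivAt_gaussDualQuermass hn hp hq hKc hKconv hK hf v₀
  obtain ⟨hcurv, heq⟩ :=
    GaussDual.integrable_and_integral_lpGaussDualCurvature hn hKc hKconv hK hg v₀ hI hp0
  refine ⟨?_, hint.integrableOn, hcurv, ?_⟩
  · obtain ⟨α, β, ρ, δ, hα, -, hδ, -, -, hbd⟩ :=
      GaussDual.exists_perturbation_bounds hn ha hg fun v => Real.rpow_pos_of_pos (hpos v) p
    refine ⟨δ, hδ, fun t ht => ?_⟩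
    have hb := hbd t (abs_lt.2 ht)
    obtain ⟨h1, h2⟩ := GaussDual.wulffShape_lpPerturbation_spec hn hp0 (half_pos hα) hb
    exact ⟨fun v => (half_pos hα).trans_le (hb v).1,
      ⟨_, GaussDual.convex_wulffShape _, h1, ⟨0, interior_subset h2⟩⟩, rfl, h2, hint.integrableOn⟩
  · rw [heq, hasDerivAt_iff_tendsto_slope] at hD
    refine hD.congr fun t => ?_
    rw [slope_def_field, sub_zero, GaussDual.wulffShape_lpPerturbation_zero hp0 hKc hKconv hK]
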